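/- **Shuffled model.** A dataset is a tuple $D\in\mathcal X^n$ ($n\ge 1$ users, one element each); two datasets are neighboring if they differ on at most one coordinate. A randomized algorithm $M$ on datasets is $(\varepsilon,\delta)$-DP if $\Pr[M(D)\in T]\le e^{\varepsilon}\Pr[M(D')\in T]+\delta$ for all neighboring $D,D'$ and all measurable $T$. A shuffled protocol has public randomness $w$, seen by all parties and by the adversary; a randomizer, which every user runs on her element with independent private randomness to obtain a sequence of messages; a shuffler, which outputs all users' messages in a uniformly random order; and an analyzer, which maps the shuffled sequence (and $w$) to a random output. The protocol is $(\varepsilon,\delta)$-DP in the communication-threat model if the pair ($w$, shuffler output) is $(\varepsilon,\delta)$-DP. A bitsum protocol has $\mathcal X=\{0,1\}$ and outputs a real estimate of $\sum_u D_u$; it is unbiased if the estimate has expectation $\sum_u D_u$ on every input, and has RMSE at most $\mathcal E_\Pi$ if the root mean squared error is at most $\mathcal E_\Pi$ on every input. **LSQ.** Let $R>0$, $\beta\ge 0$, $Q,S\in\mathbb N$. A distribution $\mathcal Q$ over pairs of functions $f,g:\mathbb R^d\to[-R,R]^Q$ is a $\beta$-approximate $(Q,R,S)$-LSQ family for a kernel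 $\mathbf k:\mathbb R^d\times\mathbb R^d\to\mathbb R$ if for all $x,y$: $|\mathbf k(x,y)-\mathbb E_{(f,g)\sim\mathcal Q}[f(x)^Tg(y)]|\le\beta$, and $f(x)$ and $g(y)$ have at most $S$ non-zero coordinates each. **The protocol.** Let $\mathcal Q$ be such a family for $\mathbf k$, let $\Pi$ be an unbiased bitsum protocol for $n$ users that is $(\varepsilon_0,\delta_0)$-DP in the shuffled model ($\varepsilon_0\ge 0$) and has RMSE at most $\mathcal E_\Pi$, and let $I\ge 1$ be an integer. Publicly sample independent $(f_1,g_1),\dots,(f_I,g_I)\sim\mathcal Q$ and the public randomness of $IQ$ independent instances $\Pi_{ij}$ of $\Pi$ ($i\in[I]$, $j\in[Q]$). A user with input $x\in\mathbb R^d$ samples independent bits $b_{ij}\sim\mathrm{Bernoulli}\big(\tfrac12(1+f_i(x)_j/R)\big)$, runs the randomizer of $\Pi_{ij}$ on $b_{ij}$ for every $(i,j)$ independently, and sends each resulting message $\gamma$ to the shuffler as $(\gamma,(i,j))$. The analyzer runs, for every $(i,j)$, the analyzer of $\Pi_{ij}$ on the shuffled messages with label $(i,j)$, obtains $\widetilde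 B_{ij}$, and publishes $\widetilde F_{ij}=(2\widetilde B_{ij}-n)R$. The released function is $\widetilde K(y)=\frac1{nI}\sum_{i=1}^I\sum_{j=1}^Q\widetilde F_{ij}\,g_i(y)_j$. **Theorem 1.** For every $\delta'>0$, put $$\varepsilon=\varepsilon_0S(e^{\varepsilon_0S}-1)I+\varepsilon_0S\sqrt{2I\ln(1/\delta')},\qquad \delta=IS\delta_0+\delta'$$ (the square root is read as $0$ if $\delta'>1$). Then: 1. the protocol is $(\varepsilon,\delta)$-DP in the communication-threat model, and its published output (the public randomness together with all $\widetilde F_{ij}$, hence the function $\widetilde K$) is $(\varepsilon,\delta)$-DP; 2. for every dataset $D=(x_1,\dots,x_n)$ in $\mathbb R^d$, with $KDE_D(y)=\frac1n\sum_u\mathbf k(x_u,y)$, $$\sup_{y\in\mathbb R^d}\sqrt{\mathbb E\big[(\widetilde K(y)-KDE_D(y))^2\big]}\ \le\ \sqrt{4\beta^2+\frac{16R^4S\big(S+(\mathcal E_\Pi/n)^2\big)}{I}};$$ 3. the protocol has bit-width $1$: every user discretizes her data to one $1$-bit value per instance $(i,j)$, and her messages in that instance depend on her data only through this value. This is optimal: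 if in a protocol with messages of this labelled form every user discretizes to $0$-bit values, then the law of the adversary's view does not depend on the dataset. -/

import Mathlib

open MeasureTheory ProbabilityTheory
open scoped NNReal ENNReal

noncomputable section

namespace ShuffledDP

/-! ### Finite sequences of messages as a measurable space -/

section MessageLists

variable {M N α β : Type*} [MeasurableSpace M] [MeasurableSpace N] [MeasurableSpace α]
  [MeasurableSpace β]

/-- The standard σ-algebra on finite sequences: the disjoint union, over all lengths `n`, of the
product σ-algebras on `Fin n → M`. -/
instance instMeasurableSpaceList : MeasurableSpace (List M) :=
  ⨅ n : ℕ, (MeasurableSpace.pi : MeasurableSpace (Fin n → M)).map List.ofFn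

lemma measurableSet_list {s : Set (List M)} :
    MeasurableSet s ↔ ∀ n : ℕ, MeasurableSet ((List.ofFn : (Fin n → M) → List M) ⁻¹' s) := by
  change MeasurableSet[⨅ n : ℕ, _] s ↔ _
  rw [MeasurableSpace.measurableSet_iInf]
  rfl

lemma measurable_ofFn (n : ℕ) : Measurable (List.ofFn : (Fin n → M) → List M) :=
  fun _ hs => measurableSet_list.1 hs n

lemma measurable_list_iff {f : List M → β} :
    Measurable f ↔ ∀ n : ℕ, Measurable fun v : Fin n → M => f (List.ofFn v) :=
  ⟨fun h n => h.comp (measurable_ofFn n), fun h _ hs => measurableSet_list.2 fun n => h n hs⟩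

lemma measurableEmbedding_ofFn (n : ℕ) :
    MeasurableEmbedding (List.ofFn : (Fin n → M) → List M) where
  injective := List.ofFn_injective
  measurable := measurable_ofFn n
  measurableSet_image' := by
    intro s hs
    refine measurableSet_list.2 fun m => ?_
    by_cases h : m = n
    · subst h
      rwa [Set.preimage_image_eq _ List.ofFn_injective]
    · convert MeasurableSet.empty
      ext v
      simp only [Set.mem_preimage, Set.mem_image, Set.mem_empty_iff_false, iff_false, not_exists,
        not_and]
      intro w _ hw
      exact h (by simpa using (congrArg List.length hw).symm)

lemma measurable_list_prod {f : List M × α → β}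
    (h : ∀ n : ℕ, Measurable fun p : (Fin n → M) × α => f (List.ofFn p.1, p.2)) :
    Measurable f := by
  intro s hs
  have : f ⁻¹' s = ⋃ n : ℕ, Prod.map (List.ofFn : (Fin n → M) → List M) id ''
      ((fun p : (Fin n → M) × α => f (List.ofFn p.1, p.2)) ⁻¹' s) := by
    ext ⟨l, a⟩
    simp only [Set.mem_preimage, Set.mem_iUnion, Set.mem_image, Prod.exists, Prod.map_apply, id]
    constructor
    · intro hl
      exact ⟨l.length, l.get, a, by simpa using hl, by simp⟩
    · rintro ⟨n, v, a', hv, h'⟩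
      simp only [Prod.mk.injEq] at h'
      rw [← h'.1, ← h'.2]
      exact hv
  rw [this]
  exact MeasurableSet.iUnion fun n =>
    ((measurableEmbedding_ofFn n).prodMap MeasurableEmbedding.id).measurableSet_image' (h n hs)

lemma measurable_append : Measurable fun p : List M × List M => p.1 ++ p.2 := by
  refine measurable_list_prod fun n => ?_
  have : Measurable fun q : List M × (Fin n → M) => List.ofFn q.2 ++ q.1 := by
    refine measurable_list_prod fun m => ?_
    have h : (fun p : (Fin m → M) × (Fin n → M) => List.ofFn p.2 ++ List.ofFn p.1)
        = fun p => List.ofFn (Fin.append p.2 p.1) := by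
      funext p
      rw [List.ofFn_fin_append]
    rw [h]
    refine (measurable_ofFn _).comp (measurable_pi_lambda _ fun i => ?_)
    refine Fin.addCases (fun j => ?_) (fun j => ?_) i
    · simp only [Fin.append_left]
      exact (measurable_pi_apply j).comp measurable_snd
    · simp only [Fin.append_right]
      exact (measurable_pi_apply j).comp measurable_fst
  exact this.comp measurable_swap

lemma measurable_listMap {g : M → N} (hg : Measurable g) : Measurable (List.map g) := by
  refine measurable_list_iff.2 fun n => ?_
  simp only [List.map_ofFn]
  exact (measurable_ofFn n).comp
    (measurable_pi_lambda _ fun i => hg.comp (measurable_pi_apply i))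

lemma measurable_flatMap {ι : Type*} (L : List ι) {F : ι → α → List M}
    (hF : ∀ i, Measurable (F i)) : Measurable fun a => L.flatMap fun i => F i a := by
  induction L with
  | nil => simp
  | cons i L ih =>
    simp only [List.flatMap_cons]
    exact measurable_append.comp ((hF i).prodMk ih)

lemma measurable_flatten_ofFn (n : ℕ) :
    Measurable fun m : Fin n → List M => (List.ofFn m).flatten := by
  have h : (fun m : Fin n → List M => (List.ofFn m).flatten)
      = fun m => (List.finRange n).flatMap fun u => m u := by
    funext m
    rw [List.ofFn_eq_map, List.flatMap_def]
  rw [h]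
  exact measurable_flatMap _ fun u => measurable_pi_apply u

end MessageLists

/-! ### Independent runs of finitely many randomized algorithms -/

/-- Given `a`, the coordinates are independent and the `i`-th one is distributed as `κ i a`. -/
def piKernel {ι α : Type*} [Fintype ι] {β : ι → Type*} [MeasurableSpace α]
    [∀ i, MeasurableSpace (β i)] (κ : ∀ i, Kernel α (β i)) [∀ i, IsMarkovKernel (κ i)] :
    Kernel α (∀ i, β i) where
  toFun a := Measure.pi fun i => κ i a
  measurable' := by
    refine Measurable.measure_of_isPiSystem_of_isProbabilityMeasure generateFrom_pi.symm
      isPiSystem_pi ?_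
    rintro _ ⟨s, hs, rfl⟩
    simp only [Measure.pi_pi]
    exact Finset.measurable_prod _ fun i _ => (κ i).measurable_coe (hs i (Set.mem_univ i))

instance {ι α : Type*} [Fintype ι] {β : ι → Type*} [MeasurableSpace α]
    [∀ i, MeasurableSpace (β i)] (κ : ∀ i, Kernel α (β i)) [∀ i, IsMarkovKernel (κ i)] :
    IsMarkovKernel (piKernel κ) :=
  ⟨fun a => inferInstanceAs (IsProbabilityMeasure (Measure.pi fun i => κ i a))⟩

/-! ### Differential privacy -/

/-- Two datasets are neighboring if they differ on at most one coordinate. -/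
def Neighboring {n : ℕ} {X : Type*} (D D' : Fin n → X) : Prop :=
  {u | D u ≠ D' u}.Subsingleton

/-- `(ε, δ)`-differential privacy of the randomized algorithm whose output on the dataset `D` has
law `mech D`. -/
def IsDP {n : ℕ} {X T : Type*} [MeasurableSpace T] (ε δ : ℝ) (mech : (Fin n → X) → Measure T) :
    Prop :=
  ∀ D D' : Fin n → X, Neighboring D D' → ∀ A : Set T, MeasurableSet A →
    (mech D).real A ≤ Real.exp ε * (mech D').real A + δ

/-! ### Protocols in the shuffled model -/

/-- The shuffler: it outputs the given sequence of messages in a uniformly random order. -/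
def shuffle (M : Type*) [MeasurableSpace M] : Kernel (List M) (List M) where
  toFun l := ((l.length.factorial : ℝ≥0∞)⁻¹) •
    ∑ σ : Equiv.Perm (Fin l.length), Measure.dirac (List.ofFn fun k => l.get (σ k))
  measurable' := by
    refine Measure.measurable_of_measurable_coe _ fun s hs => ?_
    refine measurable_list_iff.2 fun n => ?_
    have h : ∀ v : Fin n → M, ((((List.ofFn v).length.factorial : ℝ≥0∞)⁻¹) •
        ∑ σ : Equiv.Perm (Fin (List.ofFn v).length),
          Measure.dirac (List.ofFn fun k => (List.ofFn v).get (σ k))) s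
        = (n.factorial : ℝ≥0∞)⁻¹ * ∑ σ : Equiv.Perm (Fin n),
          Measure.dirac (List.ofFn fun k => v (σ k)) s := by
      intro v
      have key : ∀ (m : ℕ) (l : List M) (hl : l.length = m),
          (((l.length.factorial : ℝ≥0∞)⁻¹) • ∑ σ : Equiv.Perm (Fin l.length),
            Measure.dirac (List.ofFn fun k => l.get (σ k))) s
          = (m.factorial : ℝ≥0∞)⁻¹ * ∑ σ : Equiv.Perm (Fin m),
            Measure.dirac (List.ofFn fun k => l.get ((σ k).cast hl.symm)) s := by
        rintro m l rfl
        simp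
      rw [key n (List.ofFn v) (by simp)]
      simp
    simp only [h]
    refine Measurable.const_mul (Finset.measurable_sum _ fun σ _ => ?_) _
    have h2 : Measurable fun v : Fin n → M => List.ofFn fun k => v (σ k) :=
      (measurable_ofFn n).comp (measurable_pi_lambda _ fun k => measurable_pi_apply (σ k))
    exact (Measure.measurable_coe hs).comp (Measure.measurable_dirac.comp h2)

instance (M : Type*) [MeasurableSpace M] : IsMarkovKernel (shuffle M) := by
  refine ⟨fun l => ⟨?_⟩⟩
  change (((l.length.factorial : ℝ≥0∞)⁻¹) • ∑ σ : Equiv.Perm (Fin l.length),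
    Measure.dirac (List.ofFn fun k => l.get (σ k))) Set.univ = 1
  simp only [Measure.smul_apply, Measure.coe_finsetSum, Finset.sum_apply, measure_univ,
    Finset.sum_const, Finset.card_univ, Fintype.card_perm, Fintype.card_fin, nsmul_eq_mul,
    mul_one, smul_eq_mul]
  exact ENNReal.inv_mul_cancel (by exact_mod_cast l.length.factorial_ne_zero)
    (ENNReal.natCast_ne_top _)

/-- A protocol in the shuffled model for data elements in `X`, with public randomness in `W`,
messages in `M` and analyzer output in `Out`.
* `seed` is the law of the public randomness, which all parties (and the adversary) see;
* `randomizer x w` is the law of the message sequence of a user who holds `x`, when the public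
  randomness is `w`; it is run with private randomness, independently by each user;
* `analyzer (w, l)` is the law of the analyzer's output on the shuffled message sequence `l`. -/
structure Protocol (X W M Out : Type*) [MeasurableSpace W] [MeasurableSpace M]
    [MeasurableSpace Out] where
  seed : Measure W
  isProb_seed : IsProbabilityMeasure seed
  randomizer : X → Kernel W (List M)
  isMarkov_randomizer : ∀ x, IsMarkovKernel (randomizer x)
  analyzer : Kernel (W × List M) Out
  isMarkov_analyzer : IsMarkovKernel analyzer

attribute [instance] Protocol.isProb_seed Protocol.isMarkov_randomizer Protocol.isMarkov_analyzer

namespace Protocol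

variable {X W M Out : Type*} [MeasurableSpace W] [MeasurableSpace M] [MeasurableSpace Out]

/-- The shuffler's output on the dataset `D`, given the public randomness: all users run the
randomizer independently, and the shuffler permutes the union of their messages. -/
def shuffled (P : Protocol X W M Out) {n : ℕ} (D : Fin n → X) : Kernel W (List M) :=
  shuffle M ∘ₖ
    (piKernel fun u => P.randomizer (D u)).map fun m : Fin n → List M => (List.ofFn m).flatten

/-- The adversary's view in the communication-threat model: the public randomness together with
everything that the shuffler sends to the analyzer. -/
def view (P : Protocol X W M Out) {n : ℕ} (D : Fin n → X) : Measure (W × List M) :=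
  P.seed ⊗ₘ P.shuffled D

/-- The joint law of the public randomness and of the analyzer's published output. -/
def output (P : Protocol X W M Out) {n : ℕ} (D : Fin n → X) : Measure (W × Out) :=
  (P.view D ⊗ₘ P.analyzer).map fun p => (p.1.1, p.2)

end Protocol

/-! ### Bitsum protocols -/

/-- The sum of the users' bits. -/
def bitSum {n : ℕ} (b : Fin n → Fin 2) : ℝ := ∑ u, ((b u : ℕ) : ℝ)

section Bitsum

variable {W M : Type*} [MeasurableSpace W] [MeasurableSpace M]

/-- On every input of `n` bits, the protocol's estimate has the true sum as its expectation. -/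
def IsUnbiasedBitsum (n : ℕ) (P : Protocol (Fin 2) W M ℝ) : Prop :=
  ∀ b : Fin n → Fin 2, Integrable (fun p => p.2) (P.output b) ∧
    ∫ p, p.2 ∂(P.output b) = bitSum b

/-- The root mean squared error of a bitsum protocol with `n` users, on its worst input. -/
def bitsumRMSE (n : ℕ) (P : Protocol (Fin 2) W M ℝ) : ℝ≥0∞ :=
  ⨆ b : Fin n → Fin 2, eLpNorm (fun p => p.2 - bitSum b) 2 (P.output b)

end Bitsum

/-! ### Locality-sensitive quantization -/

/-- A distribution over pairs of functions `f, g : ℝ^d → [-R, R]^Q`: a pair `(f ω, g ω)` of such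
functions which is determined by a random `ω`. -/
structure FunctionPairDist (d Q : ℕ) (R : ℝ) (Ω : Type*) [MeasurableSpace Ω] where
  law : Measure Ω
  isProb_law : IsProbabilityMeasure law
  f : Ω → EuclideanSpace ℝ (Fin d) → Fin Q → ℝ
  g : Ω → EuclideanSpace ℝ (Fin d) → Fin Q → ℝ
  measurable_f : ∀ x j, Measurable fun ω => f ω x j
  measurable_g : ∀ y j, Measurable fun ω => g ω y j
  f_mem : ∀ ω x j, f ω x j ∈ Set.Icc (-R) R
  g_mem : ∀ ω y j, g ω y j ∈ Set.Icc (-R) R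

attribute [instance] FunctionPairDist.isProb_law

/-- `𝒬` is a `β`-approximate `(Q, R, S)`-locality-sensitive quantization family for the
kernel `k`. -/
def IsLSQ {d Q : ℕ} {R : ℝ} {Ω : Type*} [MeasurableSpace Ω] (𝒬 : FunctionPairDist d Q R Ω)
    (k : EuclideanSpace ℝ (Fin d) → EuclideanSpace ℝ (Fin d) → ℝ) (β : ℝ) (S : ℕ) : Prop :=
  (∀ x y, |k x y - ∫ ω, ∑ j, 𝒬.f ω x j * 𝒬.g ω y j ∂𝒬.law| ≤ β) ∧
  (∀ ω x, (Finset.univ.filter fun j => 𝒬.f ω x j ≠ 0).card ≤ S) ∧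
  (∀ ω y, (Finset.univ.filter fun j => 𝒬.g ω y j ≠ 0).card ≤ S)

/-! ### Running many instances side by side, and the bit-width -/

section Instances

variable {W M ι : Type*} [MeasurableSpace W] [MeasurableSpace M] [MeasurableSpace ι]

/-- The sequence of the messages that carry the label `i`, without the label. -/
def select [DecidableEq ι] (i : ι) (l : List (M × ι)) : List M :=
  l.filterMap fun m => if m.2 = i then some m.1 else none

lemma measurable_select [DecidableEq ι] [MeasurableSingletonClass ι] (i : ι) :
    Measurable (select i : List (M × ι) → List M) := by
  have h : (select i : List (M × ι) → List M)
      = fun l => l.flatMap fun m => if m.2 = i then [m.1] else [] := by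
    funext l
    induction l with
    | nil => rfl
    | cons m l ih =>
      simp only [select, List.filterMap_cons, List.flatMap_cons] at ih ⊢
      split_ifs <;> simp [ih]
  have h1 : Measurable fun m : M × ι => if m.2 = i then [m.1] else [] := by
    refine Measurable.ite (measurable_snd (measurableSet_singleton i)) ?_ measurable_const
    have : (fun m : M × ι => [m.1]) = fun m => List.ofFn fun _ : Fin 1 => m.1 := by
      funext m; simp
    rw [this]
    exact (measurable_ofFn 1).comp (measurable_pi_lambda _ fun _ => measurable_fst)
  rw [h]
  refine measurable_list_iff.2 fun n => ?_
  have h2 : (fun v : Fin n → M × ι =>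
      (List.ofFn v).flatMap fun m => if m.2 = i then [m.1] else [])
      = fun v => (List.finRange n).flatMap fun u => if (v u).2 = i then [(v u).1] else [] := by
    funext v
    rw [List.ofFn_eq_map, List.flatMap_map]
  rw [h2]
  exact measurable_flatMap _ fun u => h1.comp (measurable_pi_apply u)

variable [Fintype ι]

/-- All messages of all instances, each one labelled with its instance (the order is immaterial,
since the sequence is going to be shuffled). -/
def tagAll (Γ : ι → List M) : List (M × ι) :=
  Finset.univ.toList.flatMap fun i => (Γ i).map fun γ => (γ, i)

lemma measurable_tagAll : Measurable (tagAll : (ι → List M) → List (M × ι)) :=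
  measurable_flatMap _ fun i =>
    (measurable_listMap measurable_prodMk_right).comp (measurable_pi_apply i)

/-- Given the public randomness `w` and one value `v i` per instance, the independent message
sequences `Γ i`, where `Γ i` has law `enc i (v i) w`. -/
def encodeAll {m : ℕ} (enc : ι → Fin m → Kernel W (List M)) [∀ i v, IsMarkovKernel (enc i v)] :
    Kernel (W × (ι → Fin m)) (ι → List M) where
  toFun p := Measure.pi fun i => enc i (p.2 i) p.1
  measurable' := by
    refine measurable_from_prod_countable_left fun v => ?_
    exact (piKernel fun i => enc i (v i)).measurable

instance {m : ℕ} (enc : ι → Fin m → Kernel W (List M)) [∀ i v, IsMarkovKernel (enc i v)] :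
    IsMarkovKernel (encodeAll enc) :=
  ⟨fun p => inferInstanceAs (IsProbabilityMeasure (Measure.pi fun i => enc i (p.2 i) p.1))⟩

/-- The randomizer that first samples the values `v i` from `disc`, and then sends, for each
instance `i`, labelled messages sampled from `enc i (v i)`, independently for different `i`. -/
def discretizedRandomizer {m : ℕ} (disc : Kernel W (ι → Fin m))
    (enc : ι → Fin m → Kernel W (List M)) [∀ i v, IsMarkovKernel (enc i v)] :
    Kernel W (List (M × ι)) :=
  (disc ⊗ₖ encodeAll enc).map fun p => tagAll p.2

instance {m : ℕ} (disc : Kernel W (ι → Fin m)) [IsMarkovKernel disc]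
    (enc : ι → Fin m → Kernel W (List M)) [∀ i v, IsMarkovKernel (enc i v)] :
    IsMarkovKernel (discretizedRandomizer disc enc) :=
  Kernel.IsMarkovKernel.map _ (measurable_tagAll.comp measurable_snd)

/-- The protocol, whose messages are labelled by the instances `ι` of some subroutine, has
bit-width at most `w`: every user discretizes her data to one `w`-bit value per instance (at most
`2 ^ w` possible values), and her messages in an instance depend on her data only through the
value for that instance. -/
def HasBitWidth {X Out : Type*} [MeasurableSpace Out] (P : Protocol X W (M × ι) Out) (w : ℕ) :
    Prop :=
  ∃ (m : ℕ) (disc : X → Kernel W (ι → Fin m)) (enc : ι → Fin m → Kernel W (List M))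
    (_ : ∀ x, IsMarkovKernel (disc x)) (_ : ∀ i v, IsMarkovKernel (enc i v)),
    m ≤ 2 ^ w ∧ ∀ x, P.randomizer x = discretizedRandomizer (disc x) enc

end Instances

/-! ### Kernel density estimation and the protocol built from bitsums -/

/-- The kernel density `KDE_D(y) = (1/n) ∑ k(x, y)` of the dataset `D`. -/
def kde {d n : ℕ} (k : EuclideanSpace ℝ (Fin d) → EuclideanSpace ℝ (Fin d) → ℝ)
    (D : Fin n → EuclideanSpace ℝ (Fin d)) (y : EuclideanSpace ℝ (Fin d)) : ℝ :=
  (1 / (n : ℝ)) * ∑ u, k (D u) y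

/-- The supremum over the query points of the root mean squared error, on the dataset `D`, of a
protocol for kernel density estimation. The function that it releases is
`y ↦ query w o y`, where `w` is the public randomness and `o` the analyzer's output. -/
def supRMSE {d n : ℕ} {W M Out : Type*} [MeasurableSpace W] [MeasurableSpace M]
    [MeasurableSpace Out] (P : Protocol (EuclideanSpace ℝ (Fin d)) W M Out)
    (query : W → Out → EuclideanSpace ℝ (Fin d) → ℝ)
    (k : EuclideanSpace ℝ (Fin d) → EuclideanSpace ℝ (Fin d) → ℝ)
    (D : Fin n → EuclideanSpace ℝ (Fin d)) : ℝ≥0∞ :=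
  ⨆ y, eLpNorm (fun p => query p.1 p.2 y - kde k D y) 2 (P.output D)

section Algorithm

variable {d Q : ℕ} {R : ℝ} {Ω W M : Type*} [MeasurableSpace Ω] [MeasurableSpace W]
  [MeasurableSpace M]

/-- The rounding probability `(1 + f(x)_j / R) / 2`. -/
def roundingProb (𝒬 : FunctionPairDist d Q R Ω) (ω : Ω) (x : EuclideanSpace ℝ (Fin d))
    (j : Fin Q) : unitInterval :=
  ⟨(1 + 𝒬.f ω x j / R) / 2, by
    have h := 𝒬.f_mem ω x j
    have hR : 0 ≤ R := by linarith [h.1, h.2]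
    have h1 : 𝒬.f ω x j / R ≤ 1 := div_le_one_of_le₀ h.2 hR
    have h2 : -(𝒬.f ω x j) / R ≤ 1 := div_le_one_of_le₀ (by linarith [h.1]) hR
    rw [neg_div] at h2
    constructor <;> linarith⟩

/-- The public data: the pairs `(f_i, g_i)`, and the public randomness of all bitsum instances. -/
abbrev KDESeed (I Q : ℕ) (Ω W : Type*) : Type _ := (Fin I → Ω) × (Fin I × Fin Q → W)

/-- Randomized rounding: the bits `b_ij ∼ Bernoulli((1 + f_i(x)_j / R) / 2)` are independent. -/
def rounding (I : ℕ) (𝒬 : FunctionPairDist d Q R Ω) (W : Type*) [MeasurableSpace W]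
    (x : EuclideanSpace ℝ (Fin d)) : Kernel (KDESeed I Q Ω W) (Fin I × Fin Q → Fin 2) where
  toFun w := Measure.pi fun ij => bernoulliMeasure 1 0 (roundingProb 𝒬 (w.1 ij.1) x ij.2)
  measurable' := by
    refine Measurable.measure_of_isPiSystem_of_isProbabilityMeasure generateFrom_pi.symm
      isPiSystem_pi ?_
    rintro _ ⟨s, hs, rfl⟩
    simp only [Measure.pi_pi]
    refine Finset.measurable_prod _ fun ij _ => ?_
    have hp : Measurable fun w : KDESeed I Q Ω W => roundingProb 𝒬 (w.1 ij.1) x ij.2 := by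
      refine Measurable.subtype_mk ?_
      have hf : Measurable fun w : KDESeed I Q Ω W => 𝒬.f (w.1 ij.1) x ij.2 :=
        (𝒬.measurable_f x ij.2).comp ((measurable_pi_apply ij.1).comp measurable_fst)
      exact ((hf.div_const R).const_add 1).div_const 2
    have hB : Measurable fun p : unitInterval => bernoulliMeasure (1 : Fin 2) 0 p (s ij) := by
      simp only [bernoulliMeasure_def, Measure.coe_add, Pi.add_apply, Measure.smul_apply]
      refine Measurable.add ?_ ?_
      · exact (measurable_coe_nnreal_ennreal.comp
          (Continuous.measurable (by fun_prop))).mul_const _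
      · exact (measurable_coe_nnreal_ennreal.comp
          (Continuous.measurable (by fun_prop))).mul_const _
    exact hB.comp hp

instance (I : ℕ) (𝒬 : FunctionPairDist d Q R Ω) (x : EuclideanSpace ℝ (Fin d)) :
    IsMarkovKernel (rounding I 𝒬 W x) :=
  ⟨fun w => inferInstanceAs (IsProbabilityMeasure (Measure.pi fun ij : Fin I × Fin Q =>
    bernoulliMeasure (1 : Fin 2) 0 (roundingProb 𝒬 (w.1 ij.1) x ij.2)))⟩

/-- The randomizer of the `(i, j)`-th instance of the bitsum protocol `P`, on the bit `b`. -/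
def instanceRandomizer (I : ℕ) (P : Protocol (Fin 2) W M ℝ) (Ω : Type*) [MeasurableSpace Ω]
    (ij : Fin I × Fin Q) (b : Fin 2) : Kernel (KDESeed I Q Ω W) (List M) :=
  (P.randomizer b).comap (fun w => w.2 ij) ((measurable_pi_apply ij).comp measurable_snd)

instance (I : ℕ) (P : Protocol (Fin 2) W M ℝ) (ij : Fin I × Fin Q) (b : Fin 2) :
    IsMarkovKernel (instanceRandomizer I P Ω ij b) :=
  inferInstanceAs (IsMarkovKernel ((P.randomizer b).comap _ _))

/-- The analyzer of the `(i, j)`-th instance of `P`, on the messages labelled `(i, j)`. -/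
def instanceAnalyzer (I : ℕ) (P : Protocol (Fin 2) W M ℝ) (Ω : Type*) [MeasurableSpace Ω]
    (ij : Fin I × Fin Q) : Kernel (KDESeed I Q Ω W × List (M × (Fin I × Fin Q))) ℝ :=
  P.analyzer.comap (fun p => (p.1.2 ij, select ij p.2))
    (((measurable_pi_apply ij).comp (measurable_snd.comp measurable_fst)).prodMk
      ((measurable_select ij).comp measurable_snd))

instance (I : ℕ) (P : Protocol (Fin 2) W M ℝ) (ij : Fin I × Fin Q) :
    IsMarkovKernel (instanceAnalyzer I P Ω ij) :=
  inferInstanceAs (IsMarkovKernel (P.analyzer.comap _ _))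

/-- The analyzer's post-processing `F_ij = (2 B_ij - n) R`. -/
def rescale (n : ℕ) (R : ℝ) {ι : Type*} (B : ι → ℝ) : ι → ℝ := fun ij => (2 * B ij - n) * R

lemma measurable_rescale (n : ℕ) (R : ℝ) {ι : Type*} :
    Measurable (rescale n R : (ι → ℝ) → ι → ℝ) := by
  refine measurable_pi_lambda _ fun ij => ?_
  have h : Measurable fun B : ι → ℝ => B ij := measurable_pi_apply ij
  exact ((h.const_mul 2).sub_const (n : ℝ)).mul_const R

/-- The protocol for `n` users that is built from the bitsum protocol `P` and the LSQ family `𝒬`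
with `I` repetitions. The `I` pairs `(f_i, g_i)` and the public randomness of the `I * Q` bitsum
instances are sampled independently and published. Each user rounds the coordinates `f_i(x)_j`
to bits, runs the randomizers of the bitsum instances on them, and labels the messages with
`(i, j)`. The analyzer runs the analyzer of every instance and publishes the numbers `F_ij`. -/
def kdeProtocol (n I : ℕ) (𝒬 : FunctionPairDist d Q R Ω) (P : Protocol (Fin 2) W M ℝ) :
    Protocol (EuclideanSpace ℝ (Fin d)) (KDESeed I Q Ω W) (M × (Fin I × Fin Q))
      (Fin I × Fin Q → ℝ) where
  seed := (Measure.pi fun _ => 𝒬.law).prod (Measure.pi fun _ => P.seed)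
  isProb_seed := inferInstance
  randomizer x := discretizedRandomizer (rounding I 𝒬 W x) (instanceRandomizer I P Ω)
  isMarkov_randomizer _ := inferInstance
  analyzer := (piKernel (instanceAnalyzer I P Ω)).map (rescale n R)
  isMarkov_analyzer := Kernel.IsMarkovKernel.map _ (measurable_rescale n R)

/-- The answer `(1 / (n I)) ∑_i ∑_j F_ij g_i(y)_j` to the query `y`. -/
def kdeQuery (n I : ℕ) (𝒬 : FunctionPairDist d Q R Ω) (w : KDESeed I Q Ω W)
    (F : Fin I × Fin Q → ℝ) (y : EuclideanSpace ℝ (Fin d)) : ℝ :=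
  (1 / ((n : ℝ) * I)) * ∑ i, ∑ j, F (i, j) * 𝒬.g (w.1 i) y j

end Algorithm

end ShuffledDP

end

/-! Privacy. Fix the published function pairs. The rest of the adversary's view is obtained by
labelling and shuffling independent views of the bitsum instances, each run on randomly rounded bits
(`lintegral_kdeProtocol_view`), so it suffices to compare two product measures. Throughout, `Close c
δ P Q` is used through an equivalent form: the measure `P ⊓ c • Q` has mass at least `1 - δ`. This
form tensorizes, and it passes to `[0,1]`-valued test functions, hence to post-processing and to
averaging over the pairs.

Replacing one user's element changes only that user's rounding probabilities, and these equal `1/2`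
wherever `f` vanishes. Two `S`-sparse vectors may differ in `2S` coordinates, so counting changed
coordinates would lose a factor 2 in the exponent. The loss is avoided by going through the centre:
with `e = exp ε₀`, moving from a bit of arbitrary bias to a fair bit costs at most `2e/(1+e)`,
moving from a fair bit to an arbitrary one costs at most `(1+e)/2`, and the product is exactly `e`
(`convexCombination_le`). At most `S` moves of each kind occur, so one pair of functions costs `exp
(ε₀ S)` and `S δ₀` (`close_pi_bits_bind`). The `I` pairs are then combined by advanced composition
(`Close.pi_advanced`): up to mass `δ`, each factor is replaced by a measure whose log-likelihood
ratio `K` lies in `[-ε, ε]`; its mean is at most `ε (exp ε - 1)`, and Hoeffding's lemma with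
Chernoff's bound controls the sum of the `K`'s.

Error. Within a uniformly shuffled labelled list, the sublists of the different labels are uniformly
and independently ordered (`lintegral_select_shuffle_tagAll`). Hence, given the pairs, the
analyzers' estimates are independent and each has the law that the bitsum protocol produces on
rounded bits. The released value is an average of `I` i.i.d. block estimates, whose mean is within
`β` of the kernel density and whose second moment is at most `16 R⁴ S (S + (𝓔/n)²)`. Squared bias
plus variance gives the bound, even with `β²` in place of `4β²`.

Bit-width. A bit per instance suffices by construction; with a single possible value the randomizer
cannot depend on the data. -/

noncomputable section

namespace ShuffledDP

/-! ### Finite products of measures -/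

section PiMeasure

variable {ι : Type*} [Fintype ι] {α β : ι → Type*} [∀ i, MeasurableSpace (α i)]
  [∀ i, MeasurableSpace (β i)]

/-- Tonelli, one coordinate at a time: by induction on `s`, integrating out the coordinates in `s`
turns their partial product into a constant. -/
lemma lintegral_pi_prod (μ : ∀ i, Measure (α i)) [∀ i, SigmaFinite (μ i)]
    {f : ∀ i, α i → ℝ≥0∞} (hf : ∀ i, Measurable (f i)) :
    ∫⁻ x, ∏ i, f i (x i) ∂Measure.pi μ = ∏ i, ∫⁻ a, f i a ∂μ i := by
  classical
  have key : ∀ s : Finset ι, lmarginal μ s (fun x => ∏ i ∈ s, f i (x i))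
      = fun _ => ∏ i ∈ s, ∫⁻ a, f i a ∂μ i := by
    intro s
    induction s using Finset.induction_on with
    | empty => simp
    | insert i s hi ih =>
      rw [lmarginal_insert' _ (by fun_prop) hi]
      have h : (fun x : ∀ i, α i => ∫⁻ a, ∏ j ∈ insert i s, f j (Function.update x i a j) ∂μ i)
          = fun x => (∫⁻ a, f i a ∂μ i) • ∏ j ∈ s, f j (x j) := by
        funext x
        simp only [Finset.prod_insert hi, Function.update_self]
        rw [smul_eq_mul, ← lintegral_mul_const _ (hf i)]
        refine lintegral_congr fun a => ?_
        congr 1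
        refine Finset.prod_congr rfl fun j hj => ?_
        rw [Function.update_of_ne (by rintro rfl; exact hi hj)]
      rw [h]
      funext x
      have h2 := congrFun ih x
      simp only [lmarginal, smul_eq_mul] at h2 ⊢
      rw [lintegral_const_mul _ (by fun_prop), h2, Finset.prod_insert hi]
  by_cases hne : Nonempty (∀ i, α i)
  · obtain ⟨x⟩ := hne
    rw [lintegral_eq_lmarginal_univ x, key]
  · obtain ⟨i, hi⟩ : ∃ i, IsEmpty (α i) := by
      by_contra! h
      exact hne ⟨fun i => (h i).some⟩
    have : IsEmpty (∀ i, α i) := not_nonempty_iff.1 hne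
    rw [lintegral_of_isEmpty, Finset.prod_eq_zero (Finset.mem_univ i) (lintegral_of_isEmpty _ _)]

lemma pi_withDensity (μ : ∀ i, Measure (α i)) [∀ i, IsFiniteMeasure (μ i)]
    {f : ∀ i, α i → ℝ≥0∞} (hf : ∀ i, Measurable (f i))
    [∀ i, SigmaFinite ((μ i).withDensity (f i))] :
    Measure.pi (fun i => (μ i).withDensity (f i))
      = (Measure.pi μ).withDensity fun x => ∏ i, f i (x i) := by
  refine Measure.pi_eq fun s hs => ?_
  rw [withDensity_apply _ (.univ_pi hs), ← lintegral_indicator (.univ_pi hs)]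
  have h : ((Set.univ.pi s).indicator fun x => ∏ i, f i (x i))
      = fun x => ∏ i, (s i).indicator (f i) (x i) := by
    classical
    funext x
    by_cases hx : x ∈ Set.univ.pi s
    · rw [Set.indicator_of_mem hx]
      exact Finset.prod_congr rfl fun i _ => (Set.indicator_of_mem (hx i trivial) _).symm
    · rw [Set.indicator_of_notMem hx]
      obtain ⟨i, hi⟩ : ∃ i, x i ∉ s i := by simpa [Set.mem_pi] using hx
      exact (Finset.prod_eq_zero (Finset.mem_univ i) (Set.indicator_of_notMem hi _)).symm
  rw [h, lintegral_pi_prod μ fun i => (hf i).indicator (hs i)]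
  exact Finset.prod_congr rfl fun i _ => by
    rw [withDensity_apply _ (hs i), lintegral_indicator (hs i)]

/-- The product measure on the right comes from the largest outer measure bounded by the product on
boxes, so it is enough to compare on boxes; no finiteness of `ν` is needed. -/
lemma pi_mono {μ ν : ∀ i, Measure (α i)} [∀ i, SigmaFinite (μ i)] (h : ∀ i, μ i ≤ ν i) :
    Measure.pi μ ≤ Measure.pi ν := by
  have h1 : (Measure.pi μ).toOuterMeasure ≤ OuterMeasure.pi fun i => (ν i).toOuterMeasure := by
    rw [OuterMeasure.le_pi]
    intro s _
    change Measure.pi μ _ ≤ _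
    rw [Measure.pi_pi]
    exact Finset.prod_le_prod' fun i _ => h i (s i)
  refine Measure.le_iff.2 fun s hs => ?_
  conv_rhs => rw [Measure.pi, toMeasure_apply _ _ hs]
  exact h1 s

lemma measurable_measure_pi {γ : Type*} [MeasurableSpace γ] {κ : ∀ i, γ → Measure (β i)}
    (hκ : ∀ i, Measurable (κ i)) [∀ i c, IsProbabilityMeasure (κ i c)] :
    Measurable fun c => Measure.pi fun i => κ i c := by
  refine Measurable.measure_of_isPiSystem_of_isProbabilityMeasure generateFrom_pi.symm
    isPiSystem_pi ?_
  rintro _ ⟨s, hs, rfl⟩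
  simp only [Measure.pi_pi]
  exact Finset.measurable_prod _ fun i _ =>
    (Measure.measurable_coe (hs i (Set.mem_univ i))).comp (hκ i)

/-- Drawing the coordinates independently in two stages. -/
lemma pi_bind (μ : ∀ i, Measure (α i)) [∀ i, IsProbabilityMeasure (μ i)]
    {κ : ∀ i, α i → Measure (β i)} (hκ : ∀ i, Measurable (κ i))
    [∀ i a, IsProbabilityMeasure (κ i a)] :
    (Measure.pi μ).bind (fun a => Measure.pi fun i => κ i (a i))
      = Measure.pi fun i => (μ i).bind (κ i) := by
  have hF : Measurable fun a : ∀ i, α i => Measure.pi fun i => κ i (a i) :=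
    measurable_measure_pi fun i => (hκ i).comp (measurable_pi_apply i)
  have : ∀ i, IsProbabilityMeasure ((μ i).bind (κ i)) := fun i =>
    isProbabilityMeasure_bind (hκ i).aemeasurable (.of_forall inferInstance)
  refine (Measure.pi_eq fun s hs => ?_).symm
  rw [Measure.bind_apply (.univ_pi hs) hF.aemeasurable]
  simp only [Measure.pi_pi]
  rw [lintegral_pi_prod μ (f := fun i a => κ i a (s i))
    fun i => (Measure.measurable_coe (hs i)).comp (hκ i)]
  exact Finset.prod_congr rfl fun i _ => by
    rw [Measure.bind_apply (hs i) (hκ i).aemeasurable]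

end PiMeasure

/-! ### Approximate indistinguishability of two measures -/

section Closeness

variable {α : Type*} [MeasurableSpace α]

/-- One-sided `(log c, δ)`-indistinguishability of two measures. -/
def Close (c : ℝ≥0) (δ : ℝ≥0∞) (P Q : Measure α) : Prop :=
  ∀ A, MeasurableSet A → P A ≤ c * Q A + δ

variable {P Q : Measure α} {c : ℝ≥0} {δ : ℝ≥0∞}

/-- On a Hahn set `s` one has `P ≤ c • Q`, and the reverse on `sᶜ`. Gluing the smaller measure on
each side gives a lower bound of both, and its mass is controlled by the hypothesis for the single
set `sᶜ`. -/
lemma Close.one_le_inf [IsProbabilityMeasure P] [IsFiniteMeasure Q] (h : Close c δ P Q) :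
    1 ≤ (P ⊓ c • Q) Set.univ + δ := by
  obtain ⟨s, hs, h1, h2⟩ := hahn_decomposition (c • Q) P
  have hle : P.restrict s + (c • Q).restrict sᶜ ≤ P ⊓ c • Q := by
    refine le_inf ?_ ?_ <;> refine Measure.le_iff.2 fun t ht => ?_
    · rw [Measure.add_apply, Measure.restrict_apply ht, Measure.restrict_apply ht,
        ← measure_inter_add_sdiff t hs]
      exact add_le_add le_rfl (h2 _ (ht.inter hs.compl) Set.inter_subset_right)
    · rw [Measure.add_apply, Measure.restrict_apply ht, Measure.restrict_apply ht,
        ← measure_inter_add_sdiff (μ := c • Q) t hs]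
      exact add_le_add (h1 _ (ht.inter hs) Set.inter_subset_right) le_rfl
  calc (1 : ℝ≥0∞) = P s + P sᶜ := (prob_add_prob_compl hs).symm
    _ ≤ P s + (c * Q sᶜ + δ) := by gcongr; exact h _ hs.compl
    _ = (P.restrict s + (c • Q).restrict sᶜ) Set.univ + δ := by
        simp [add_assoc]
    _ ≤ _ := by gcongr

/-- The total deficit of `m` is at most `δ`, and the complement of `A` can only add to it. -/
lemma measure_le_of_le_of_one_le {m : Measure α} [IsProbabilityMeasure P] (hm : m ≤ P)
    (h1 : 1 ≤ m Set.univ + δ) {A : Set α} (hA : MeasurableSet A) : P A ≤ m A + δ := by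
  have h2 : P A + P Aᶜ ≤ m A + m Aᶜ + δ := by
    rw [prob_add_prob_compl hA, measure_add_measure_compl hA]; exact h1
  have h3 : P A + P Aᶜ ≤ m A + δ + P Aᶜ := by
    refine h2.trans ?_
    rw [add_right_comm]
    gcongr
  exact (ENNReal.add_le_add_iff_right (measure_ne_top P _)).1 h3

/-- Converse of `Close.one_le_inf`: closeness is a statement about one mass. -/
lemma Close.of_inf [IsProbabilityMeasure P] (h : 1 ≤ (P ⊓ c • Q) Set.univ + δ) :
    Close c δ P Q := fun A hA =>
  (measure_le_of_le_of_one_le inf_le_left h hA).trans <| by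
    gcongr
    exact (inf_le_right : P ⊓ c • Q ≤ c • Q) A

/-- Splitting `P` into the common part `P ⊓ c • Q` and a remainder of mass at most `δ` handles all
`[0,1]`-valued test functions at once. This is what makes randomized post-processing free. -/
lemma Close.lintegral_le [IsProbabilityMeasure P] [IsFiniteMeasure Q] (h : Close c δ P Q)
    {φ : α → ℝ≥0∞} (hφ1 : ∀ a, φ a ≤ 1) :
    ∫⁻ a, φ a ∂P ≤ c * ∫⁻ a, φ a ∂Q + δ := by
  set m := P ⊓ c • Q
  have hm : m ≤ P := inf_le_left
  have hmQ : m ≤ c • Q := inf_le_right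
  have : IsFiniteMeasure m := isFiniteMeasure_of_le P hm
  have hP : ∫⁻ a, φ a ∂P = ∫⁻ a, φ a ∂(P - m) + ∫⁻ a, φ a ∂m := by
    rw [← lintegral_add_measure, Measure.sub_add_cancel_of_le hm]
  rw [hP, add_comm]
  refine add_le_add ?_ ?_
  · refine (lintegral_mono' hmQ le_rfl).trans ?_
    rw [lintegral_smul_measure]
    rfl
  · calc ∫⁻ a, φ a ∂(P - m) ≤ ∫⁻ _, 1 ∂(P - m) := lintegral_mono hφ1
      _ = 1 - m Set.univ := by
        rw [lintegral_one, Measure.sub_apply .univ hm, measure_univ]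
      _ ≤ δ := tsub_le_iff_left.2 h.one_le_inf

/-- The inequality `∏ (1 - dᵢ) ≥ 1 - ∑ dᵢ`, written without subtraction. -/
lemma one_le_prod_add_sum {ι : Type*} (s : Finset ι) {a d : ι → ℝ≥0∞} (ha : ∀ i, a i ≤ 1)
    (h : ∀ i, 1 ≤ a i + d i) : 1 ≤ ∏ i ∈ s, a i + ∑ i ∈ s, d i := by
  classical
  induction s using Finset.induction_on with
  | empty => simp
  | insert i s hi ih =>
    rw [Finset.prod_insert hi, Finset.sum_insert hi]
    calc (1 : ℝ≥0∞) ≤ a i + d i := h i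
      _ ≤ a i * (∏ j ∈ s, a j + ∑ j ∈ s, d j) + d i := by
        gcongr; exact le_mul_of_one_le_right' ih
      _ = a i * ∏ j ∈ s, a j + a i * ∑ j ∈ s, d j + d i := by ring
      _ ≤ a i * ∏ j ∈ s, a j + 1 * ∑ j ∈ s, d j + d i := by gcongr; exact ha i
      _ = _ := by ring

end Closeness

/-! ### Basic composition -/

section Composition

variable {ι : Type*} [Fintype ι] {α : ι → Type*} [∀ i, MeasurableSpace (α i)]
  {P Q : ∀ i, Measure (α i)} [∀ i, IsProbabilityMeasure (P i)] [∀ i, IsProbabilityMeasure (Q i)]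

/-- Basic composition. -/
lemma Close.pi {c : ι → ℝ≥0} {δ : ι → ℝ≥0∞} (h : ∀ i, Close (c i) (δ i) (P i) (Q i)) :
    Close (∏ i, c i) (∑ i, δ i) (Measure.pi P) (Measure.pi Q) := by
  have : ∀ i, IsFiniteMeasure (P i ⊓ c i • Q i) := fun i =>
    isFiniteMeasure_of_le (P i) inf_le_left
  have hQ : Measure.pi (fun i => c i • Q i) = (∏ i, c i) • Measure.pi Q := by
    refine Measure.pi_eq fun s _ => ?_
    simp only [Measure.coe_nnreal_smul_apply, Measure.pi_pi, Finset.prod_mul_distrib,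
      ENNReal.ofNNReal_finsetProd]
  -- The product of the measures `P i ⊓ c i • Q i` lies below both products, and its mass is the
  -- product of the masses.
  refine Close.of_inf (le_trans (one_le_prod_add_sum Finset.univ (fun i => ?_)
    fun i => (h i).one_le_inf) (add_le_add (le_trans (Measure.pi_univ _).ge ?_) le_rfl))
  · exact ((inf_le_left : P i ⊓ c i • Q i ≤ P i) _).trans_eq measure_univ
  · refine (le_inf (pi_mono fun i => inf_le_left) ?_ :
      Measure.pi (fun i => P i ⊓ c i • Q i) ≤ _) Set.univ
    rw [← hQ]
    exact pi_mono fun i => inf_le_right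

end Composition

/-! ### Reduction to bounded log-likelihood ratios -/

section Decomposition

variable {α : Type*} [MeasurableSpace α] {P Q : Measure α} {c : ℝ≥0} {δ : ℝ≥0∞}

lemma measure_smul_mono {μ ν : Measure α} (h : μ ≤ ν) (c : ℝ≥0) : c • μ ≤ c • ν :=
  Measure.le_iff.2 fun s _ => by
    simp only [Measure.coe_nnreal_smul_apply]
    gcongr

lemma measure_le_smul_of_one_le (hc : 1 ≤ c) (μ : Measure α) : μ ≤ c • μ :=
  Measure.le_iff.2 fun s _ => by
    simp only [Measure.coe_nnreal_smul_apply]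
    exact le_mul_of_one_le_left' (by exact_mod_cast hc)

lemma le_smul_inf {n μ ν : Measure α} (hc : 1 ≤ c) (h1 : n ≤ c • μ) (h2 : n ≤ c • ν) :
    n ≤ c • (μ ⊓ ν) := by
  have hc0 : c ≠ 0 := by rintro rfl; simp at hc
  have h : c⁻¹ • n ≤ μ ⊓ ν := by
    refine le_inf ?_ ?_
    · refine (measure_smul_mono h1 _).trans_eq ?_
      rw [smul_smul, inv_mul_cancel₀ hc0, one_smul]
    · refine (measure_smul_mono h2 _).trans_eq ?_
      rw [smul_smul, inv_mul_cancel₀ hc0, one_smul]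
  have h3 := measure_smul_mono h c
  rwa [smul_smul, mul_inv_cancel₀ hc0, one_smul] at h3

/-- Two-sided `(log c, δ)`-indistinguishable probability measures dominate, up to mass `δ`, two
measures with density ratio in `[c⁻¹, c]`. -/
lemma Close.exists_pure [IsProbabilityMeasure P] [IsProbabilityMeasure Q] (hc : 1 ≤ c)
    (h : Close c δ P Q) (h' : Close c δ Q P) :
    ∃ n q : Measure α, n ≤ P ∧ q ≤ Q ∧ n ≤ c • q ∧ q ≤ c • n ∧ n Set.univ ≤ q Set.univ ∧
      1 ≤ n Set.univ + δ := by
  -- Both infima have mass at least `1 - δ` and density ratio in `[c⁻¹, c]`; only the comparison of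
  -- their masses may fail. That comparison is needed for the bound on the mean log-likelihood
  -- ratio.
  set n₀ := P ⊓ c • Q
  set q₀ := Q ⊓ c • P
  have hnP : n₀ ≤ P := inf_le_left
  have hqQ : q₀ ≤ Q := inf_le_left
  have hnq : n₀ ≤ c • q₀ :=
    le_smul_inf hc inf_le_right (hnP.trans ((measure_le_smul_of_one_le hc P).trans
      (measure_le_smul_of_one_le hc _)))
  have hqn : q₀ ≤ c • n₀ :=
    le_smul_inf hc inf_le_right (hqQ.trans ((measure_le_smul_of_one_le hc Q).trans
      (measure_le_smul_of_one_le hc _)))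
  have hn1 : 1 ≤ n₀ Set.univ + δ := h.one_le_inf
  have hq1 : 1 ≤ q₀ Set.univ + δ := h'.one_le_inf
  by_cases hle : n₀ Set.univ ≤ q₀ Set.univ
  · exact ⟨n₀, q₀, hnP, hqQ, hnq, hqn, hle, hn1⟩
  -- Here `n₀` is too heavy. The measure `b` is no heavier than `q₀` and still dominates `q₀` up to
  -- the factor `c`, so the convex combination of `n₀` and `b` with the mass of `q₀` keeps both
  -- density bounds.
  set b := n₀ ⊓ q₀
  have hbn : b ≤ n₀ := inf_le_left
  have hqb : q₀ ≤ c • b := le_smul_inf hc hqn (measure_le_smul_of_one_le hc _)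
  have : IsFiniteMeasure n₀ := isFiniteMeasure_of_le P hnP
  have : IsFiniteMeasure q₀ := isFiniteMeasure_of_le Q hqQ
  have : IsFiniteMeasure b := isFiniteMeasure_of_le n₀ hbn
  have hbq : b Set.univ ≤ q₀ Set.univ := (inf_le_right : b ≤ q₀) _
  obtain ⟨u, t, hut, hmass⟩ : ∃ u t : ℝ≥0, u + t = 1 ∧
      u * n₀ Set.univ + t * b Set.univ = q₀ Set.univ := by
    generalize hA : n₀ Set.univ = A at *
    generalize hB : b Set.univ = B at *
    generalize hS : q₀ Set.univ = S at *
    lift A to ℝ≥0 using by rw [← hA]; finiteness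
    lift B to ℝ≥0 using by rw [← hB]; finiteness
    lift S to ℝ≥0 using by rw [← hS]; finiteness
    norm_cast at hle hbq ⊢
    have hlt : S < A := not_le.1 hle
    have h1 : (A : ℝ) - B > 0 := by
      have : (B : ℝ) < A := by exact_mod_cast hbq.trans_lt hlt
      linarith
    have h2 : 0 ≤ (S : ℝ) - B := by
      have : (B : ℝ) ≤ S := by exact_mod_cast hbq
      linarith
    have h3 : 0 ≤ (A : ℝ) - S := by
      have : (S : ℝ) ≤ A := by exact_mod_cast hlt.le
      linarith
    refine ⟨((S - B : ℝ) / (A - B)).toNNReal, ((A - S : ℝ) / (A - B)).toNNReal, ?_, ?_⟩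
    · apply NNReal.eq
      push_cast
      rw [Real.coe_toNNReal _ (by positivity), Real.coe_toNNReal _ (by positivity)]
      field_simp
      ring
    · apply NNReal.eq
      push_cast
      rw [Real.coe_toNNReal _ (by positivity), Real.coe_toNNReal _ (by positivity)]
      field_simp
      ring
  have hsplit : ∀ μ : Measure α, u • μ + t • μ = μ := fun μ => by
    rw [← add_smul, hut, one_smul]
  have hn : u • n₀ + t • b ≤ n₀ :=
    (add_le_add le_rfl (measure_smul_mono hbn t)).trans_eq (hsplit n₀)
  have hmass' : (u • n₀ + t • b) Set.univ = q₀ Set.univ := by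
    rw [← hmass]
    simp only [Measure.add_apply, Measure.coe_nnreal_smul_apply]
  refine ⟨u • n₀ + t • b, q₀, hn.trans hnP, hqQ, hn.trans hnq, ?_, hmass'.le, hmass' ▸ hq1⟩
  rw [smul_add, smul_comm c u, smul_comm c t]
  calc q₀ = u • q₀ + t • q₀ := (hsplit q₀).symm
    _ ≤ _ := add_le_add (measure_smul_mono hqn u) (measure_smul_mono hqb t)

/-- The logarithm of the Radon–Nikodym derivative lies in `[-ε, ε]` almost everywhere; clipping it
makes the bound hold everywhere without changing the measure. -/
lemma exists_log_density {n q : Measure α} [IsFiniteMeasure n] [IsFiniteMeasure q] {ε : ℝ}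
    (hε : 0 ≤ ε) (h1 : n ≤ (Real.exp ε).toNNReal • q) (h2 : q ≤ (Real.exp ε).toNNReal • n) :
    ∃ K : α → ℝ, Measurable K ∧ (∀ a, |K a| ≤ ε) ∧
      n = q.withDensity fun a => ENNReal.ofReal (Real.exp (K a)) := by
  have hac : n ≪ q := Measure.absolutelyContinuous_of_le_smul (c := (Real.exp ε).toNNReal) h1
  set f := n.rnDeriv q
  have hf : Measurable f := Measure.measurable_rnDeriv n q
  have hn : q.withDensity f = n := Measure.withDensity_rnDeriv_eq n q hac
  have hup : f ≤ᵐ[q] fun _ => ENNReal.ofReal (Real.exp ε) := by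
    refine ae_le_of_forall_setLIntegral_le_of_sigmaFinite hf fun s hs _ => ?_
    rw [setLIntegral_const, ← withDensity_apply _ hs, hn]
    exact h1 s
  have hlow : (fun _ => 1) ≤ᵐ[q] fun a => ENNReal.ofReal (Real.exp ε) * f a := by
    refine ae_le_of_forall_setLIntegral_le_of_sigmaFinite measurable_const fun s hs _ => ?_
    rw [setLIntegral_const, one_mul, lintegral_const_mul _ hf, ← withDensity_apply _ hs, hn]
    exact h2 s
  refine ⟨fun a => max (-ε) (min ε (Real.log (f a).toReal)), by fun_prop, fun a => ?_, ?_⟩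
  · rw [abs_le]
    exact ⟨le_max_left _ _, max_le (by linarith) (min_le_left _ _)⟩
  · rw [← hn]
    refine withDensity_congr_ae ?_
    filter_upwards [hup, hlow] with a ha hb
    have hfin : f a ≠ ∞ := (ha.trans_lt ENNReal.ofReal_lt_top).ne
    have h3 : (f a).toReal ≤ Real.exp ε := ENNReal.toReal_le_of_le_ofReal (Real.exp_pos _).le ha
    have h4 : 1 ≤ Real.exp ε * (f a).toReal := by
      have := ENNReal.toReal_mono (by finiteness) hb
      rwa [ENNReal.toReal_one, ENNReal.toReal_mul, ENNReal.toReal_ofReal (Real.exp_pos _).le] at this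
    have h5 : 0 < (f a).toReal := by
      by_contra! h
      nlinarith [Real.exp_pos ε]
    have h6 : Real.log (f a).toReal ≤ ε := by
      rwa [Real.log_le_iff_le_exp h5]
    have h7 : -ε ≤ Real.log (f a).toReal := by
      rw [Real.le_log_iff_exp_le h5, Real.exp_neg, inv_le_iff_one_le_mul₀ (Real.exp_pos _)]
      linarith
    rw [min_eq_right h6, max_eq_right h7, Real.exp_log h5, ENNReal.ofReal_toReal hfin]

/-- The moment generating function of a bounded log-likelihood ratio. -/
lemma lintegral_exp_mul_log_density_le {n q : Measure α} [IsFiniteMeasure n] {K : α → ℝ} {ε s : ℝ}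
    (hs : 0 ≤ s) (hK : Measurable K) (hKε : ∀ a, |K a| ≤ ε)
    (hn : n = q.withDensity fun a => ENNReal.ofReal (Real.exp (K a)))
    (hnq : n Set.univ ≤ q Set.univ) (hn1 : n Set.univ ≤ 1) :
    ∫⁻ a, ENNReal.ofReal (Real.exp (s * K a)) ∂n
      ≤ ENNReal.ofReal (Real.exp (s * (ε * (Real.exp ε - 1)) + s ^ 2 * ε ^ 2 / 2)) := by
  by_cases hn0 : n = 0
  · rw [hn0]; simp
  have hm0 : n Set.univ ≠ 0 := by simpa using hn0
  -- Normalization, since Hoeffding's lemma needs a probability measure; the mass given up is at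
  -- most 1.
  set N : Measure α := (n Set.univ)⁻¹ • n with hN
  have hNn : n = n Set.univ • N := by
    rw [hN, smul_smul, ENNReal.mul_inv_cancel hm0 (measure_ne_top _ _), one_smul]
  have hNprob : IsProbabilityMeasure N :=
    ⟨by rw [hN, Measure.smul_apply, smul_eq_mul, ENNReal.inv_mul_cancel hm0 (measure_ne_top _ _)]⟩
  have hint : ∀ g : ℝ → ℝ, Continuous g → Integrable (fun a => g (K a)) N := by
    intro g hg
    obtain ⟨C, hC⟩ := (isCompact_Icc (a := -ε) (b := ε)).exists_bound_of_continuousOn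
      hg.continuousOn
    exact Integrable.of_bound (hg.measurable.comp hK).aestronglyMeasurable C
      (.of_forall fun a => hC _ (abs_le.1 (hKε a)))
  -- The integral equals the ratio of the masses of `q` and `n`; this is where `n Set.univ ≤ q
  -- Set.univ` enters.
  have hexp : (1 : ℝ) ≤ ∫ a, Real.exp (-K a) ∂N := by
    have h1 : ∫⁻ a, ENNReal.ofReal (Real.exp (-K a)) ∂n = q Set.univ := by
      rw [hn, lintegral_withDensity_eq_lintegral_mul _ (by fun_prop) (by fun_prop)]
      simp [← ENNReal.ofReal_mul (Real.exp_pos _).le, ← Real.exp_add]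
    have h2 : (1 : ℝ≥0∞) ≤ ∫⁻ a, ENNReal.ofReal (Real.exp (-K a)) ∂N := by
      rw [hN, lintegral_smul_measure, h1, smul_eq_mul, mul_comm, ← div_eq_mul_inv]
      exact (ENNReal.le_div_iff_mul_le (.inl hm0) (.inl (measure_ne_top _ _))).2 (by simpa)
    rw [← ofReal_integral_eq_lintegral_ofReal (hint (fun x => Real.exp (-x)) (by fun_prop))
      (.of_forall fun a => (Real.exp_pos _).le)] at h2
    exact ENNReal.one_le_ofReal.1 h2
  have hmean : ∫ a, K a ∂N ≤ ε * (Real.exp ε - 1) := by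
    -- Write `K = K (1 - e^{-K}) + K e^{-K}`: the first term is at most `ε (e^ε - 1)`, the second at
    -- most `1 - e^{-K}` because `K + 1 ≤ e^K`. The mean of `1 - e^{-K}` is nonpositive by `hexp`.
    have hpt : ∀ a, K a ≤ ε * (Real.exp ε - 1) + (1 - Real.exp (-K a)) := by
      intro a
      have hk := abs_le.1 (hKε a)
      have hε : 0 ≤ ε := (abs_nonneg _).trans (hKε a)
      have h1 : |1 - Real.exp (-K a)| ≤ Real.exp ε - 1 := by
        have ha : Real.exp (-K a) ≤ Real.exp ε := Real.exp_le_exp.2 (by linarith)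
        have hb : 1 - K a ≤ Real.exp (-K a) := by linarith [Real.add_one_le_exp (-K a)]
        have hc : ε + 1 ≤ Real.exp ε := Real.add_one_le_exp ε
        rw [abs_le]; constructor <;> linarith
      have h2 : K a * (1 - Real.exp (-K a)) ≤ ε * (Real.exp ε - 1) :=
        (le_abs_self _).trans (by rw [abs_mul]; exact mul_le_mul (hKε a) h1 (abs_nonneg _) hε)
      have h3 : K a * Real.exp (-K a) ≤ 1 - Real.exp (-K a) := by
        have := Real.add_one_le_exp (K a)
        have h4 : Real.exp (K a) * Real.exp (-K a) = 1 := by rw [← Real.exp_add]; simp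
        nlinarith [Real.exp_pos (-K a)]
      linarith
    have hi1 := hint (fun x => x) continuous_id
    have hi2 := hint (fun x => Real.exp (-x)) (by fun_prop)
    have hi3 := hint (fun x => 1 - Real.exp (-x)) (by fun_prop)
    calc ∫ a, K a ∂N ≤ ∫ a, (ε * (Real.exp ε - 1) + (1 - Real.exp (-K a))) ∂N :=
          integral_mono hi1 ((integrable_const _).add hi3) hpt
      _ = ε * (Real.exp ε - 1) + (1 - ∫ a, Real.exp (-K a) ∂N) := by
          rw [integral_add (integrable_const _) hi3,
            integral_sub (integrable_const _) hi2]
          simp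
      _ ≤ _ := by linarith
  -- Hoeffding's lemma on an interval of length `2ε`: the variance proxy is `ε²`.
  have hoeff := (hasSubgaussianMGF_of_mem_Icc (μ := N) hK.aemeasurable
    (.of_forall fun a => Set.mem_Icc.2 (abs_le.1 (hKε a)))).mgf_le s
  have hε : 0 ≤ ε := by
    obtain ⟨a⟩ : Nonempty α := by
      by_contra h
      rw [not_nonempty_iff] at h
      exact hn0 (Measure.eq_zero_of_isEmpty n)
    exact (abs_nonneg _).trans (hKε a)
  have hmgf : ∫ a, Real.exp (s * K a) ∂N
      ≤ Real.exp (s * (ε * (Real.exp ε - 1)) + s ^ 2 * ε ^ 2 / 2) := by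
    have h1 : ∫ a, Real.exp (s * K a) ∂N
        = Real.exp (s * ∫ a, K a ∂N) * mgf (fun a => K a - ∫ a, K a ∂N) N s := by
      rw [mgf, ← integral_const_mul]
      refine integral_congr_ae (.of_forall fun a => ?_)
      simp only
      rw [← Real.exp_add]
      congr 1
      ring
    rw [h1, Real.exp_add]
    refine mul_le_mul (Real.exp_le_exp.2 (mul_le_mul_of_nonneg_left hmean hs)) ?_ mgf_nonneg
      (Real.exp_pos _).le
    refine hoeff.trans (Real.exp_le_exp.2 (le_of_eq ?_))
    push_cast
    rw [Real.norm_eq_abs, show ε - -ε = 2 * ε by ring, abs_of_nonneg (by linarith)]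
    ring
  calc ∫⁻ a, ENNReal.ofReal (Real.exp (s * K a)) ∂n
      = n Set.univ * ∫⁻ a, ENNReal.ofReal (Real.exp (s * K a)) ∂N := by
        conv_lhs => rw [hNn]
        rw [lintegral_smul_measure, smul_eq_mul]
    _ ≤ 1 * ∫⁻ a, ENNReal.ofReal (Real.exp (s * K a)) ∂N := by gcongr
    _ = ENNReal.ofReal (∫ a, Real.exp (s * K a) ∂N) := by
        rw [one_mul, ← ofReal_integral_eq_lintegral_ofReal
          (hint (fun x => Real.exp (s * x)) (by fun_prop))
          (.of_forall fun a => (Real.exp_pos _).le)]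
    _ ≤ _ := ENNReal.ofReal_le_ofReal hmgf

end Decomposition

/-! ### Advanced composition -/

section Composition

variable {ι : Type*} [Fintype ι] {α : ι → Type*} [∀ i, MeasurableSpace (α i)]
  {P Q : ∀ i, Measure (α i)} [∀ i, IsProbabilityMeasure (P i)] [∀ i, IsProbabilityMeasure (Q i)]

/-- Chernoff's bound for the sum of the log-likelihood ratios. -/
lemma pi_lt_sum_le {n : ∀ i, Measure (α i)} [∀ i, IsFiniteMeasure (n i)] {K : ∀ i, α i → ℝ}
    (hK : ∀ i, Measurable (K i)) {s b E : ℝ} (hs : 0 ≤ s)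
    (h : ∀ i, ∫⁻ a, ENNReal.ofReal (Real.exp (s * K i a)) ∂n i ≤ ENNReal.ofReal (Real.exp b)) :
    Measure.pi n {x | E < ∑ i, K i (x i)} ≤ ENNReal.ofReal (Real.exp (Fintype.card ι * b - s * E)) := by
  have hprod : ∀ x : ∀ i, α i, ENNReal.ofReal (Real.exp (s * (∑ i, K i (x i) - E)))
      = ENNReal.ofReal (Real.exp (-(s * E))) * ∏ i, ENNReal.ofReal (Real.exp (s * K i (x i))) := by
    intro x
    rw [← ENNReal.ofReal_prod_of_nonneg fun _ _ => (Real.exp_pos _).le,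
      ← ENNReal.ofReal_mul (Real.exp_pos _).le, ← Real.exp_sum, ← Real.exp_add, mul_sub,
      Finset.mul_sum]
    congr 2
    ring
  have hmeas : MeasurableSet {x : ∀ i, α i | E < ∑ i, K i (x i)} :=
    measurableSet_lt measurable_const (by fun_prop)
  calc Measure.pi n {x | E < ∑ i, K i (x i)}
      = ∫⁻ x in {x | E < ∑ i, K i (x i)}, 1 ∂Measure.pi n := by simp
    _ ≤ ∫⁻ x in {x | E < ∑ i, K i (x i)},
          ENNReal.ofReal (Real.exp (s * (∑ i, K i (x i) - E))) ∂Measure.pi n := by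
        refine setLIntegral_mono (by fun_prop) fun x hx => ?_
        rw [ENNReal.one_le_ofReal, Real.one_le_exp_iff]
        exact mul_nonneg hs (sub_nonneg.2 (le_of_lt hx))
    _ ≤ ∫⁻ x, ENNReal.ofReal (Real.exp (s * (∑ i, K i (x i) - E))) ∂Measure.pi n :=
        setLIntegral_le_lintegral _ _
    _ = ENNReal.ofReal (Real.exp (-(s * E)))
          * ∏ i, ∫⁻ a, ENNReal.ofReal (Real.exp (s * K i a)) ∂n i := by
        simp_rw [hprod]
        rw [lintegral_const_mul _ (by fun_prop),
          lintegral_pi_prod n (f := fun i a => ENNReal.ofReal (Real.exp (s * K i a)))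
            fun i => by fun_prop]
    _ ≤ ENNReal.ofReal (Real.exp (-(s * E))) * ∏ _i : ι, ENNReal.ofReal (Real.exp b) := by
        gcongr with i
        exact h i
    _ = _ := by
        rw [Finset.prod_const, Finset.card_univ, ← ENNReal.ofReal_pow (Real.exp_pos _).le,
          ← ENNReal.ofReal_mul (Real.exp_pos _).le, ← Real.exp_nat_mul, ← Real.exp_add]
        congr 2
        ring

/-- Advanced composition. -/
theorem Close.pi_advanced [Nonempty ι] {ε δ' : ℝ} {δ : ℝ≥0∞} (hε : 0 ≤ ε) (hδ' : 0 < δ')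
    (h : ∀ i, Close (Real.exp ε).toNNReal δ (P i) (Q i))
    (h' : ∀ i, Close (Real.exp ε).toNNReal δ (Q i) (P i)) :
    Close (Real.exp (ε * (Real.exp ε - 1) * Fintype.card ι
        + ε * Real.sqrt (2 * Fintype.card ι * Real.log (1 / δ')))).toNNReal
      (Fintype.card ι * δ + ENNReal.ofReal δ') (Measure.pi P) (Measure.pi Q) := by
  -- The Chernoff parameter below divides by `ε²`; for `ε = 0` basic composition already suffices.
  rcases hε.eq_or_lt with rfl | hε
  · intro A hA
    have h0 := Close.pi h A hA
    simp only [Real.exp_zero, Real.toNNReal_one, Finset.prod_const_one, Finset.sum_const,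
      Finset.card_univ, nsmul_eq_mul, zero_mul, zero_add] at h0 ⊢
    exact h0.trans (by gcongr; exact le_self_add)
  intro A hA
  -- For `δ' > 1` the additive term exceeds every probability; otherwise the logarithm under the
  -- square root is nonnegative.
  by_cases hδ1 : 1 < δ'
  · calc Measure.pi P A ≤ 1 := prob_le_one
      _ ≤ ENNReal.ofReal δ' := ENNReal.one_le_ofReal.2 hδ1.le
      _ ≤ _ := le_add_self.trans le_add_self
  set m : ℝ := (Fintype.card ι : ℝ) with hm
  have hm0 : 0 < m := by rw [hm]; exact_mod_cast Fintype.card_pos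
  set L := Real.log (1 / δ') with hLdef
  have hL : 0 ≤ L := Real.log_nonneg (by rw [le_div_iff₀ hδ']; linarith)
  set t := ε * Real.sqrt (2 * m * L) with ht
  have ht0 : 0 ≤ t := by positivity
  have ht2 : t ^ 2 = 2 * m * L * ε ^ 2 := by
    rw [ht, mul_pow, Real.sq_sqrt (by positivity)]; ring
  set E := ε * (Real.exp ε - 1) * m + t with hE
  -- After the mean terms cancel, the Chernoff exponent is `m s² ε² / 2 - s t`. This `s` is its
  -- minimizer, with value `-t² / (2 m ε²) = -L = log δ'`, which is what fixes `t`.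
  set s := t / (m * ε ^ 2) with hs
  have hs0 : 0 ≤ s := by positivity
  have hc : 1 ≤ (Real.exp ε).toNNReal := by
    rw [Real.one_le_toNNReal]; exact Real.one_le_exp hε.le
  choose n q hnP hqQ hnq hqn hmass hone using fun i => Close.exists_pure hc (h i) (h' i)
  have : ∀ i, IsFiniteMeasure (n i) := fun i => isFiniteMeasure_of_le _ (hnP i)
  have : ∀ i, IsFiniteMeasure (q i) := fun i => isFiniteMeasure_of_le _ (hqQ i)
  choose K hK hKε hnK using fun i => exists_log_density hε.le (hnq i) (hqn i)
  have hn1 : ∀ i, n i Set.univ ≤ 1 := fun i => (hnP i _).trans_eq measure_univ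
  have htail : Measure.pi n {x | E < ∑ i, K i (x i)} ≤ ENNReal.ofReal δ' := by
    refine (pi_lt_sum_le hK hs0 fun i => lintegral_exp_mul_log_density_le hs0 (hK i) (hKε i)
      (hnK i) (hmass i) (hn1 i)).trans (ENNReal.ofReal_le_ofReal (le_of_eq ?_))
    have h1 : (Fintype.card ι : ℝ) * (s * (ε * (Real.exp ε - 1)) + s ^ 2 * ε ^ 2 / 2) - s * E
        = -L := by
      rw [← hm, hE]
      have h2 : m * (s ^ 2 * ε ^ 2 / 2) - s * t = -(t ^ 2 / (2 * m * ε ^ 2)) := by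
        rw [hs]; field_simp; ring
      have h3 : t ^ 2 / (2 * m * ε ^ 2) = L := by rw [ht2]; field_simp
      linear_combination h2 - h3
    rw [h1, hLdef, one_div, Real.log_inv, neg_neg, Real.exp_log hδ']
  have hdens : Measure.pi n = (Measure.pi q).withDensity
      fun x => ∏ i, ENNReal.ofReal (Real.exp (K i (x i))) := by
    have : ∀ i, SigmaFinite ((q i).withDensity fun a => ENNReal.ofReal (Real.exp (K i a))) :=
      fun i => by rw [← hnK i]; infer_instance
    rw [← pi_withDensity q (f := fun i a => ENNReal.ofReal (Real.exp (K i a)))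
      fun i => by fun_prop]
    congr 1
    exact funext hnK
  have hset : MeasurableSet {x : ∀ i, α i | E < ∑ i, K i (x i)} :=
    measurableSet_lt measurable_const (by fun_prop)
  -- Off the tail event the density of the product, the exponential of the sum of the `K i`, is at
  -- most `exp E`.
  have hbulk : Measure.pi n (A \ {x | E < ∑ i, K i (x i)})
      ≤ ENNReal.ofReal (Real.exp E) * Measure.pi Q A := by
    rw [hdens, withDensity_apply _ (hA.diff hset)]
    calc ∫⁻ x in A \ {x | E < ∑ i, K i (x i)}, ∏ i, ENNReal.ofReal (Real.exp (K i (x i)))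
          ∂Measure.pi q
        ≤ ∫⁻ x in A \ {x | E < ∑ i, K i (x i)}, ENNReal.ofReal (Real.exp E) ∂Measure.pi q := by
          refine setLIntegral_mono measurable_const fun x hx => ?_
          rw [← ENNReal.ofReal_prod_of_nonneg fun _ _ => (Real.exp_pos _).le, ← Real.exp_sum]
          exact ENNReal.ofReal_le_ofReal (Real.exp_le_exp.2 (not_lt.1 hx.2))
      _ = ENNReal.ofReal (Real.exp E) * Measure.pi q (A \ {x | E < ∑ i, K i (x i)}) :=
          setLIntegral_const _ _
      _ ≤ ENNReal.ofReal (Real.exp E) * Measure.pi Q A := by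
          exact mul_le_mul_right ((measure_mono Set.sdiff_subset).trans (pi_mono hqQ A)) _
  have hmassn : 1 ≤ Measure.pi n Set.univ + Fintype.card ι * δ := by
    have := one_le_prod_add_sum Finset.univ hn1 hone
    rwa [← Measure.pi_univ, Finset.sum_const, Finset.card_univ, nsmul_eq_mul] at this
  calc Measure.pi P A ≤ Measure.pi n A + Fintype.card ι * δ :=
        measure_le_of_le_of_one_le (pi_mono hnP) hmassn hA
    _ ≤ (Measure.pi n (A \ {x | E < ∑ i, K i (x i)}) + Measure.pi n {x | E < ∑ i, K i (x i)})
          + Fintype.card ι * δ := by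
        gcongr
        exact (measure_mono (by intro x hx; by_cases h : E < ∑ i, K i (x i) <;> simp [hx, h])).trans
          (measure_union_le _ _)
    _ ≤ (ENNReal.ofReal (Real.exp E) * Measure.pi Q A + ENNReal.ofReal δ')
          + Fintype.card ι * δ := by gcongr
    _ = _ := by
        rw [add_assoc, add_comm (ENNReal.ofReal δ')]
        rfl

end Composition

/-! ### Closeness in real-valued form -/

section Closeness

variable {α : Type*} [MeasurableSpace α] {P Q : Measure α}

lemma Close.mono {c c' : ℝ≥0} {δ δ' : ℝ≥0∞} (h : Close c δ P Q) (hc : c ≤ c') (hδ : δ ≤ δ') :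
    Close c' δ' P Q := fun A hA => (h A hA).trans <| by gcongr

lemma close_iff_real [IsFiniteMeasure P] [IsFiniteMeasure Q] {c δ : ℝ} (hc : 0 ≤ c) (hδ : 0 ≤ δ) :
    Close c.toNNReal (ENNReal.ofReal δ) P Q ↔
      ∀ A, MeasurableSet A → P.real A ≤ c * Q.real A + δ := by
  refine forall₂_congr fun A _ => ?_
  have h : (c.toNNReal : ℝ≥0∞) * Q A + ENNReal.ofReal δ = ENNReal.ofReal (c * Q.real A + δ) := by
    rw [ENNReal.ofReal_add (by positivity) hδ, ENNReal.ofReal_mul hc, ofReal_measureReal]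
    rfl
  rw [h, ← ofReal_measureReal (μ := P), ENNReal.ofReal_le_ofReal_iff (by positivity)]

end Closeness

/-! ### Privacy of randomized rounding -/

section Mixture

/-- The factor lost in the privacy of a mixture, when one weight is `p` and the other is `1/2`. -/
def halfWeight (p c : ℝ) : ℝ := if p = 1 / 2 then 1 else c

/-- Adding `x` or `y` to the hypotheses gives `(x + y - δ)/(1 + e) ≤ x, y ≤ (e (x + y) + δ)/(1 +
e)`, so every mixture lies between these bounds and is compared with the midpoint `(x + y)/2` at the
cost of one factor and at most `δ/2`. If neither weight is `1/2`, the two factors multiply to `e`,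
the trivial cost. -/
lemma convexCombination_le {x y e δ p p' : ℝ} (hx : 0 ≤ x) (hy : 0 ≤ y) (he : 1 ≤ e)
    (hδ : 0 ≤ δ) (h1 : x ≤ e * y + δ) (h2 : y ≤ e * x + δ) (hp : p ∈ Set.Icc (0 : ℝ) 1)
    (hp' : p' ∈ Set.Icc (0 : ℝ) 1) :
    p * x + (1 - p) * y ≤ halfWeight p (2 * e / (1 + e)) * halfWeight p' ((1 + e) / 2)
        * (p' * x + (1 - p') * y)
      + ((if p = 1 / 2 then 0 else δ / 2) + (if p' = 1 / 2 then 0 else δ / 2)) := by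
  obtain ⟨hp0, hp1⟩ := hp
  obtain ⟨hp0', hp1'⟩ := hp'
  have conv : ∀ {q a b M : ℝ}, 0 ≤ q → q ≤ 1 → a ≤ M → b ≤ M → q * a + (1 - q) * b ≤ M := by
    intro q a b M h0 h1 ha hb
    nlinarith [mul_le_mul_of_nonneg_left ha h0, mul_le_mul_of_nonneg_left hb (sub_nonneg.2 h1)]
  have conv' : ∀ {q a b M : ℝ}, 0 ≤ q → q ≤ 1 → M ≤ a → M ≤ b → M ≤ q * a + (1 - q) * b := by
    intro q a b M h0 h1 ha hb
    nlinarith [mul_le_mul_of_nonneg_left ha h0, mul_le_mul_of_nonneg_left hb (sub_nonneg.2 h1)]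
  have hpos : 0 < 1 + e := by linarith
  unfold halfWeight
  split_ifs with h h' h'
  · subst h; subst h'; linarith
  · subst h
    have hz : (x + y - δ) / (1 + e) ≤ p' * x + (1 - p') * y := by
      refine conv' hp0' hp1' ?_ ?_ <;> rw [div_le_iff₀ hpos] <;> linarith
    rw [div_le_iff₀ hpos] at hz
    linarith
  · subst h'
    have hz : p * x + (1 - p) * y ≤ (e * (x + y) + δ) / (1 + e) := by
      refine conv hp0 hp1 ?_ ?_ <;> rw [le_div_iff₀ hpos] <;> linarith
    have hle : δ / (1 + e) ≤ δ / 2 := by gcongr; linarith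
    have : (e * (x + y) + δ) / (1 + e)
        = 2 * e / (1 + e) * 1 * (1 / 2 * x + (1 - 1 / 2) * y) + δ / (1 + e) := by
      field_simp; ring
    linarith
  · have hc : 2 * e / (1 + e) * ((1 + e) / 2) = e := by field_simp
    rw [hc]
    refine conv hp0 hp1 ?_ ?_
    · have := conv' hp0' hp1' (a := e * x + δ) (b := e * y + δ) (M := x) (by nlinarith) h1
      linarith
    · have := conv' hp0' hp1' (a := e * x + δ) (b := e * y + δ) (M := y) h2 (by nlinarith)
      linarith

variable {ι : Type*} [Fintype ι] [DecidableEq ι]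

/-- Independent bits with the given success probabilities. -/
def bits (p : ι → unitInterval) : Measure (ι → Fin 2) :=
  Measure.pi fun v => bernoulliMeasure 1 0 (p v)

instance (p : ι → unitInterval) : IsProbabilityMeasure (bits p) :=
  inferInstanceAs (IsProbabilityMeasure (Measure.pi _))

/-- A deterministic bit can be produced by overwriting a random one, so both values of the bit are
coupled to the same remaining bits. -/
lemma bits_update_eq_map (p : ι → unitInterval) (u : ι) (c : unitInterval) (b : Fin 2)
    (hc : bernoulliMeasure (1 : Fin 2) 0 c = Measure.dirac b) :
    bits (Function.update p u c) = (bits p).map fun x => Function.update x u b := by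
  have h : (fun x : ι → Fin 2 => Function.update x u b)
      = fun x v => (if v = u then fun _ => b else id : Fin 2 → Fin 2) (x v) := by
    funext x v
    by_cases hv : v = u
    · subst hv; simp
    · simp [hv]
  have hm : ∀ v, Measurable (if v = u then fun _ => b else id : Fin 2 → Fin 2) :=
    fun v => measurable_from_top
  have : ∀ v, IsProbabilityMeasure ((bernoulliMeasure (1 : Fin 2) 0 (p v)).map
      (if v = u then fun _ => b else id : Fin 2 → Fin 2)) :=
    fun v => Measure.isProbabilityMeasure_map (hm v).aemeasurable
  rw [h, bits, bits, Measure.pi_map_pi fun v => (hm v).aemeasurable]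
  congr 1
  funext v
  by_cases hv : v = u
  · subst hv; simp [hc]
  · simp [hv]

/-- Conditioning on the bit of `u`. -/
lemma bits_eq_add (p : ι → unitInterval) (u : ι) :
    bits p = unitInterval.toNNReal (p u) • bits (Function.update p u 1)
      + unitInterval.toNNReal (unitInterval.symm (p u)) • bits (Function.update p u 0) := by
  have key : ∀ (c : unitInterval) (s : ι → Set (Fin 2)),
      bits (Function.update p u c) (Set.univ.pi s)
        = bernoulliMeasure 1 0 c (s u)
          * ∏ v ∈ Finset.univ.erase u, bernoulliMeasure 1 0 (p v) (s v) := by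
    intro c s
    rw [bits, Measure.pi_pi, ← Finset.mul_prod_erase _ _ (Finset.mem_univ u),
      Function.update_self]
    congr 1
    refine Finset.prod_congr rfl fun v hv => ?_
    rw [Function.update_of_ne (Finset.ne_of_mem_erase hv)]
  refine Measure.pi_eq fun s _ => ?_
  simp only [Measure.add_apply, Measure.coe_nnreal_smul_apply, key]
  rw [← Finset.mul_prod_erase _ _ (Finset.mem_univ u), ← mul_assoc, ← mul_assoc, ← add_mul]
  congr 1
  simp only [bernoulliMeasure_def, unitInterval.symm_zero, unitInterval.symm_one,
    unitInterval.toNNReal_zero, unitInterval.toNNReal_one, one_smul, zero_smul, add_zero, zero_add]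
  rfl

variable {T : Type*} [MeasurableSpace T] {V : (ι → Fin 2) → Measure T}

instance [∀ b, IsProbabilityMeasure (V b)] (p : ι → unitInterval) :
    IsProbabilityMeasure ((bits p).bind V) :=
  isProbabilityMeasure_bind (measurable_of_countable V).aemeasurable (.of_forall inferInstance)

omit [DecidableEq ι] in
lemma bits_bind_apply (p : ι → unitInterval) {A : Set T} (hA : MeasurableSet A) :
    (bits p).bind V A = ∫⁻ b, V b A ∂bits p :=
  Measure.bind_apply hA (measurable_of_countable V).aemeasurable

lemma close_bits_bind_update [∀ b, IsProbabilityMeasure (V b)] {c : ℝ≥0} {δ : ℝ≥0∞} {u : ι}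
    {a b : Fin 2} {qa qb : unitInterval}
    (ha : bernoulliMeasure (1 : Fin 2) 0 qa = Measure.dirac a)
    (hb : bernoulliMeasure (1 : Fin 2) 0 qb = Measure.dirac b)
    (h : ∀ x, Close c δ (V (Function.update x u a)) (V (Function.update x u b)))
    (p : ι → unitInterval) :
    Close c δ ((bits (Function.update p u qa)).bind V)
      ((bits (Function.update p u qb)).bind V) := by
  intro A hA
  rw [bits_bind_apply _ hA, bits_bind_apply _ hA, bits_update_eq_map p u qa a ha,
    bits_update_eq_map p u qb b hb, lintegral_map (measurable_of_countable _)
    (measurable_of_countable _), lintegral_map (measurable_of_countable _)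
    (measurable_of_countable _)]
  calc ∫⁻ x, V (Function.update x u a) A ∂bits p
      ≤ ∫⁻ x, (c * V (Function.update x u b) A + δ) ∂bits p := lintegral_mono fun x => h x A hA
    _ = _ := by
        rw [lintegral_add_right _ measurable_const, lintegral_const_mul _ (measurable_of_countable _)]
        simp

/-- Randomized rounding of a single coordinate: no privacy is lost if the rounding probability is
`1/2` for both inputs, and about half the privacy if it is `1/2` for one of them. -/
lemma close_bits_bind [∀ b, IsProbabilityMeasure (V b)] {e δ : ℝ} (he : 1 ≤ e) (hδ : 0 ≤ δ) {u : ι}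
    (h : ∀ (x : ι → Fin 2) (a b : Fin 2), Close e.toNNReal (ENNReal.ofReal δ)
      (V (Function.update x u a)) (V (Function.update x u b)))
    {p p' : ι → unitInterval} (hpp' : ∀ v, v ≠ u → p v = p' v) :
    Close (halfWeight (p u) (2 * e / (1 + e)) * halfWeight (p' u) ((1 + e) / 2)).toNNReal
      (ENNReal.ofReal ((if (p u : ℝ) = 1 / 2 then 0 else δ / 2)
        + (if (p' u : ℝ) = 1 / 2 then 0 else δ / 2)))
      ((bits p).bind V) ((bits p').bind V) := by
  have hupd : ∀ c, Function.update p' u c = Function.update p u c := by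
    intro c
    funext v
    by_cases hv : v = u
    · subst hv; simp
    · simp [hv, hpp' v hv]
  -- As `p` and `p'` agree off `u`, both laws are mixtures of the same two conditional laws `X` and
  -- `Y`, given that the bit of `u` is 1 or 0.
  set X := (bits (Function.update p u 1)).bind V
  set Y := (bits (Function.update p u 0)).bind V
  have e0 : (0 : ℝ) ≤ e := by linarith
  have hXY : Close e.toNNReal (ENNReal.ofReal δ) X Y :=
    close_bits_bind_update (bernoulliMeasure_one _ _) (bernoulliMeasure_zero _ _)
      (fun x => h x 1 0) p
  have hYX : Close e.toNNReal (ENNReal.ofReal δ) Y X :=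
    close_bits_bind_update (bernoulliMeasure_zero _ _) (bernoulliMeasure_one _ _)
      (fun x => h x 0 1) p
  rw [close_iff_real e0 hδ] at hXY hYX
  have hsplit : ∀ q : ι → unitInterval, (∀ c, Function.update q u c = Function.update p u c) →
      ∀ A, MeasurableSet A →
        ((bits q).bind V).real A = q u * X.real A + (1 - q u) * Y.real A := by
    intro q hq A hA
    have h1 : (bits q).bind V A = unitInterval.toNNReal (q u) * X A
        + unitInterval.toNNReal (unitInterval.symm (q u)) * Y A := by
      rw [bits_bind_apply _ hA, bits_eq_add q u, lintegral_add_measure, lintegral_smul_measure,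
        lintegral_smul_measure, hq, hq, ← bits_bind_apply _ hA, ← bits_bind_apply _ hA]
      rfl
    rw [measureReal_def, h1, ENNReal.toReal_add (by finiteness) (by finiteness),
      ENNReal.toReal_mul, ENNReal.toReal_mul]
    rfl
  have hw : ∀ (q : unitInterval) {c : ℝ}, 0 ≤ c → 0 ≤ halfWeight q c := by
    intro q c hc
    unfold halfWeight
    split_ifs <;> linarith
  refine (close_iff_real (mul_nonneg (hw _ (by positivity)) (hw _ (by positivity)))
    (by positivity)).2 fun A hA => ?_
  rw [hsplit p (fun _ => rfl) A hA, hsplit p' hupd A hA]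
  exact convexCombination_le measureReal_nonneg measureReal_nonneg he hδ (hXY A hA) (hYX A hA)
    (p u).2 (p' u).2

/-- Randomized rounding of a vector with at most `S` non-centered coordinates. -/
lemma close_pi_bits_bind [∀ b, IsProbabilityMeasure (V b)] {κ : Type*} [Fintype κ] {S : ℕ}
    {ε δ : ℝ} (hε : 0 ≤ ε) (hδ : 0 ≤ δ) {u : ι}
    (h : ∀ (x : ι → Fin 2) (a b : Fin 2), Close (Real.exp ε).toNNReal (ENNReal.ofReal δ)
      (V (Function.update x u a)) (V (Function.update x u b)))
    {p p' : κ → ι → unitInterval} (hpp' : ∀ j v, v ≠ u → p j v = p' j v)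
    (hS : (Finset.univ.filter fun j => (p j u : ℝ) ≠ 1 / 2).card ≤ S)
    (hS' : (Finset.univ.filter fun j => (p' j u : ℝ) ≠ 1 / 2).card ≤ S) :
    Close (Real.exp (ε * S)).toNNReal (ENNReal.ofReal (S * δ))
      (Measure.pi fun j => (bits (p j)).bind V) (Measure.pi fun j => (bits (p' j)).bind V) := by
  set e := Real.exp ε
  have he : 1 ≤ e := Real.one_le_exp hε
  have hpos : 0 < 1 + e := by linarith
  have hr : 1 ≤ 2 * e / (1 + e) := by rw [le_div_iff₀ hpos]; linarith
  have hs : 1 ≤ (1 + e) / 2 := by linarith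
  have hprod : ∀ (q : κ → ι → unitInterval) (c : ℝ), 1 ≤ c →
      (Finset.univ.filter fun j => (q j u : ℝ) ≠ 1 / 2).card ≤ S →
      ∏ j, (halfWeight (q j u) c).toNNReal ≤ c.toNNReal ^ S := by
    intro q c hc hq
    have : ∀ j, (halfWeight (q j u) c).toNNReal
        = if (q j u : ℝ) ≠ 1 / 2 then c.toNNReal else 1 := by
      intro j
      unfold halfWeight
      split_ifs <;> simp_all
    simp_rw [this]
    rw [Finset.prod_ite, Finset.prod_const, Finset.prod_const_one, mul_one]
    exact pow_le_pow_right₀ (Real.one_le_toNNReal.2 hc) hq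
  have hsum : ∀ q : κ → ι → unitInterval,
      (Finset.univ.filter fun j => (q j u : ℝ) ≠ 1 / 2).card ≤ S →
      ∑ j, (if (q j u : ℝ) = 1 / 2 then 0 else δ / 2) ≤ S * (δ / 2) := by
    intro q hq
    have : ∀ j, (if (q j u : ℝ) = 1 / 2 then 0 else δ / 2)
        = if (q j u : ℝ) ≠ 1 / 2 then δ / 2 else 0 := fun j => by split_ifs <;> simp_all
    simp_rw [this]
    rw [Finset.sum_ite, Finset.sum_const, Finset.sum_const_zero, add_zero, nsmul_eq_mul]
    gcongr
  refine (Close.pi fun j => close_bits_bind he hδ h (hpp' j)).mono ?_ ?_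
  · have hw : ∀ (q : unitInterval) {c : ℝ}, 0 ≤ c → 0 ≤ halfWeight q c := by
      intro q c hc
      unfold halfWeight
      split_ifs <;> linarith
    simp_rw [Real.toNNReal_mul (hw (p _ u) (by positivity : 0 ≤ 2 * e / (1 + e)))]
    rw [Finset.prod_mul_distrib]
    -- At most `S` factors of each kind occur, and `(2e/(1+e))^S ((1+e)/2)^S = e^S`. Likewise the
    -- two sums of halves of `δ` give `S δ`, not `2 S δ`.
    refine (mul_le_mul' (hprod p _ hr hS) (hprod p' _ hs hS')).trans (le_of_eq ?_)
    rw [← mul_pow, ← Real.toNNReal_mul (by positivity),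
      show 2 * e / (1 + e) * ((1 + e) / 2) = e by field_simp, ← Real.toNNReal_pow (by positivity),
      mul_comm, Real.exp_nat_mul]
  · rw [← ENNReal.ofReal_sum_of_nonneg fun j _ => by positivity, Finset.sum_add_distrib]
    refine ENNReal.ofReal_le_ofReal ?_
    linarith [hsum p hS, hsum p' hS']

end Mixture

/-! ### Permutations of labelled lists -/

section Lists

variable {M N : Type*}

lemma perm_ofFn_iff {n : ℕ} {f : Fin n → M} {l : List M} :
    l.Perm (List.ofFn f) ↔ ∃ τ : Equiv.Perm (Fin n), l = List.ofFn (f ∘ τ) := by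
  constructor
  · intro h
    rw [List.ofFn_eq_map] at h
    -- Messages may repeat, so the permutation is read off from the list of positions, which has no
    -- duplicates.
    have h2 : Relation.Comp (fun a b => a = List.map f b) List.Perm l (List.finRange n) := by
      rw [List.eq_map_comp_perm]; exact h
    obtain ⟨L, rfl, hL⟩ := h2
    have hlen : L.length = n := by simpa using hL.length_eq
    obtain ⟨g, rfl⟩ : ∃ g : Fin n → Fin n, L = List.ofFn g := by
      have key : ∀ m, L.length = m → ∃ g : Fin m → Fin n, L = List.ofFn g := by
        rintro _ rfl
        exact ⟨_, (List.ofFn_get L).symm⟩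
      exact key n hlen
    have hg : Function.Injective g := List.nodup_ofFn.1 (hL.nodup_iff.2 (List.nodup_finRange n))
    refine ⟨Equiv.ofBijective g (Finite.injective_iff_bijective.1 hg), ?_⟩
    rw [List.map_ofFn]
    rfl
  · rintro ⟨τ, rfl⟩
    exact τ.ofFn_comp_perm f

variable {ι : Type*} [DecidableEq ι]

lemma select_perm (i : ι) {l l' : List (M × ι)} (h : l.Perm l') :
    (select i l).Perm (select i l') :=
  h.filterMap _

lemma select_map (i : ι) (f : M → N) (l : List (M × ι)) :
    select i (l.map (Prod.map f id)) = (select i l).map f := by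
  simp only [select, List.filterMap_map, List.map_filterMap]
  congr 1
  funext m
  simp only [Function.comp_apply, Prod.map_fst, Prod.map_snd, id]
  split_ifs <;> rfl

variable [Fintype ι]

omit [DecidableEq ι] in
lemma tagAll_perm {Γ Γ' : ι → List M} (h : ∀ i, (Γ i).Perm (Γ' i)) :
    (tagAll Γ).Perm (tagAll Γ') :=
  List.Perm.flatMap_left _ fun i _ => (h i).map _

omit [DecidableEq ι] in
lemma tagAll_map (f : M → N) (Γ : ι → List M) :
    (tagAll Γ).map (Prod.map f id) = tagAll fun i => (Γ i).map f := by
  simp only [tagAll, List.map_flatMap, List.map_map]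
  rfl

lemma select_tagAll (i : ι) (Γ : ι → List M) : select i (tagAll Γ) = Γ i := by
  have key : ∀ L : List ι, L.Nodup →
      select i (L.flatMap fun i => (Γ i).map fun γ => (γ, i)) = if i ∈ L then Γ i else [] := by
    intro L
    induction L with
    | nil => intro _; rfl
    | cons j L ih =>
      intro hL
      rw [List.nodup_cons] at hL
      have ih := ih hL.2
      simp only [select] at ih
      simp only [List.flatMap_cons, select, List.filterMap_append, ih, List.filterMap_map]
      by_cases hij : j = i
      · subst hij
        have : (Γ j).filterMap ((fun m : M × ι => if m.2 = j then some m.1 else none) ∘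
            fun γ => (γ, j)) = (Γ j).filterMap some := by
          congr 1
          funext γ
          simp
        rw [this, List.filterMap_some]
        simp [hL.1]
      · have : (Γ j).filterMap ((fun m : M × ι => if m.2 = i then some m.1 else none) ∘
            fun γ => (γ, j)) = [] := by
          rw [List.filterMap_eq_nil_iff]
          intro γ _
          simp [hij]
        rw [this]
        simp [Ne.symm hij]
  rw [tagAll, key _ (Finset.nodup_toList _)]
  simp

end Lists

/-! ### The uniform shuffle and its effect on each label -/

section Shuffle

variable {M : Type*} [MeasurableSpace M]

lemma lintegral_shuffle_ofFn {n : ℕ} (f : Fin n → M) {φ : List M → ℝ≥0∞} (hφ : Measurable φ) :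
    ∫⁻ l, φ l ∂shuffle M (List.ofFn f)
      = (n.factorial : ℝ≥0∞)⁻¹ * ∑ σ : Equiv.Perm (Fin n), φ (List.ofFn (f ∘ σ)) := by
  -- The length is made a variable, so that the permutations of `Fin l.length` can be transported
  -- along an equality.
  have key : ∀ (m : ℕ) (l : List M) (hl : l.length = m),
      ∫⁻ l', φ l' ∂shuffle M l = (m.factorial : ℝ≥0∞)⁻¹ * ∑ σ : Equiv.Perm (Fin m),
        φ (List.ofFn fun k => l.get ((σ k).cast hl.symm)) := by
    rintro m l rfl
    change ∫⁻ l', φ l' ∂(((l.length.factorial : ℝ≥0∞)⁻¹) •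
      ∑ σ : Equiv.Perm (Fin l.length), Measure.dirac (List.ofFn fun k => l.get (σ k))) = _
    rw [lintegral_smul_measure, lintegral_finsetSum_measure, smul_eq_mul]
    simp [lintegral_dirac' _ hφ]
  rw [key n _ (by simp)]
  simp only [List.get_ofFn]
  rfl

/-- Left translation by a fixed permutation preserves the uniform average. -/
lemma shuffle_eq_of_perm {l l' : List M} (h : l.Perm l') : shuffle M l = shuffle M l' := by
  refine Measure.ext_of_lintegral _ fun φ hφ => ?_
  rw [← List.ofFn_get l'] at h ⊢
  obtain ⟨τ, rfl⟩ := perm_ofFn_iff.1 h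
  rw [lintegral_shuffle_ofFn _ hφ, lintegral_shuffle_ofFn _ hφ]
  congr 1
  exact Fintype.sum_equiv (Equiv.mulLeft τ) _ _ fun σ => rfl

section Pi

variable {ι : Type*} [Fintype ι] [DecidableEq ι]

/-- A product of uniform averages is the uniform average over tuples of permutations. -/
lemma lintegral_pi_shuffle_ofFn {n : ι → ℕ} (f : ∀ i, Fin (n i) → M)
    {φ : (ι → List M) → ℝ≥0∞} (hφ : Measurable φ) :
    ∫⁻ Λ, φ Λ ∂Measure.pi (fun i => shuffle M (List.ofFn (f i)))
      = (Fintype.card (∀ i, Equiv.Perm (Fin (n i))) : ℝ≥0∞)⁻¹ *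
        ∑ e : ∀ i, Equiv.Perm (Fin (n i)), φ fun i => List.ofFn (f i ∘ e i) := by
  have h : Measure.pi (fun i => shuffle M (List.ofFn (f i)))
      = (Fintype.card (∀ i, Equiv.Perm (Fin (n i))) : ℝ≥0∞)⁻¹ •
        ∑ e : ∀ i, Equiv.Perm (Fin (n i)), Measure.dirac fun i => List.ofFn (f i ∘ e i) := by
    refine (Measure.pi_eq fun s hs => ?_)
    have h1 : ∀ i, shuffle M (List.ofFn (f i)) (s i) = ((n i).factorial : ℝ≥0∞)⁻¹ *
        ∑ σ : Equiv.Perm (Fin (n i)), (s i).indicator 1 (List.ofFn (f i ∘ σ)) := by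
      intro i
      rw [← lintegral_indicator_one (hs i),
        lintegral_shuffle_ofFn _ (measurable_one.indicator (hs i))]
    simp_rw [h1]
    rw [Finset.prod_mul_distrib, Finset.prod_univ_sum, Fintype.piFinset_univ, Measure.smul_apply,
      Measure.coe_finsetSum, Finset.sum_apply, smul_eq_mul]
    congr 1
    · rw [Fintype.card_pi]
      push_cast
      rw [ENNReal.prod_inv_distrib]
      · simp [Fintype.card_perm]
      · intro i _ j _ _
        left
        exact_mod_cast Fintype.card_ne_zero
    · refine Finset.sum_congr rfl fun e _ => ?_
      rw [Measure.dirac_apply' _ (.univ_pi hs)]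
      by_cases hmem : (fun i => List.ofFn (f i ∘ e i)) ∈ Set.univ.pi s
      · rw [Set.indicator_of_mem hmem]
        exact (Finset.prod_eq_one fun i _ => Set.indicator_of_mem (hmem i trivial) _).symm
      · rw [Set.indicator_of_notMem hmem]
        obtain ⟨i, hi⟩ : ∃ i, List.ofFn (f i ∘ e i) ∉ s i := by simpa [Set.mem_pi] using hmem
        exact (Finset.prod_eq_zero (Finset.mem_univ i) (Set.indicator_of_notMem hi _)).symm
  rw [h, lintegral_smul_measure, lintegral_finsetSum_measure, smul_eq_mul]
  simp [lintegral_dirac' _ hφ]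

lemma lintegral_pi_shuffle_of_invariant (Γ : ι → List M) {φ : (ι → List M) → ℝ≥0∞}
    (hφ : Measurable φ) (h : ∀ Λ : ι → List M, (∀ i, (Λ i).Perm (Γ i)) → φ Λ = φ Γ) :
    ∫⁻ Λ, φ Λ ∂Measure.pi (fun i => shuffle M (Γ i)) = φ Γ := by
  have h1 : Γ = fun i => List.ofFn (Γ i).get := funext fun i => (List.ofFn_get (Γ i)).symm
  rw [h1, lintegral_pi_shuffle_ofFn _ hφ, ← h1]
  have h2 : ∀ e : ∀ i, Equiv.Perm (Fin (Γ i).length),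
      φ (fun i => List.ofFn ((Γ i).get ∘ e i)) = φ Γ := fun e =>
    h _ fun i => ((e i).ofFn_comp_perm _).trans (by rw [List.ofFn_get])
  simp_rw [h2]
  rw [Finset.sum_const, Finset.card_univ, nsmul_eq_mul, ← mul_assoc,
    ENNReal.inv_mul_cancel (by exact_mod_cast Fintype.card_ne_zero) (ENNReal.natCast_ne_top _),
    one_mul]

/-- A uniformly random order of a labelled sequence orders the messages of the different labels
uniformly and independently. -/
theorem lintegral_select_shuffle_tagAll (Γ : ι → List M) {φ : (ι → List M) → ℝ≥0∞}
    [MeasurableSpace ι] [MeasurableSingletonClass ι] (hφ : Measurable φ) :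
    ∫⁻ l, φ (fun i => select i l) ∂shuffle (M × ι) (tagAll Γ)
      = ∫⁻ Λ, φ Λ ∂Measure.pi fun i => shuffle M (Γ i) := by
  obtain ⟨n, f, rfl⟩ : ∃ (n : ι → ℕ) (f : ∀ i, Fin (n i) → M), Γ = fun i => List.ofFn (f i) :=
    ⟨fun i => (Γ i).length, fun i => (Γ i).get, funext fun i => (List.ofFn_get (Γ i)).symm⟩
  -- Messages are replaced by distinct tokens `(i, k)` naming their positions, and `g` reads off the
  -- message; thus permutations act on tokens even when messages coincide.
  set g : (Σ i, Fin (n i)) → M := fun p => f p.1 p.2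
  set J : List ((Σ i, Fin (n i)) × ι) := tagAll
    fun i => List.ofFn fun k : Fin (n i) => (⟨i, k⟩ : Σ i, Fin (n i)) with hJ
  obtain ⟨N, j, hj⟩ : ∃ (N : ℕ) (j : Fin N → (Σ i, Fin (n i)) × ι), J = List.ofFn j :=
    ⟨J.length, J.get, (List.ofFn_get J).symm⟩
  have hΓ : tagAll (fun i => List.ofFn (f i)) = List.ofFn (Prod.map g id ∘ j) := by
    rw [← List.map_ofFn, ← hj, hJ, tagAll_map]
    simp only [List.map_ofFn]
    rfl
  have hsel : Measurable fun l : List (M × ι) => φ fun i => select i l :=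
    hφ.comp (measurable_pi_lambda _ fun i => measurable_select i)
  rw [hΓ, lintegral_shuffle_ofFn _ hsel, lintegral_pi_shuffle_ofFn _ hφ]
  have hstep : ∀ σ : Equiv.Perm (Fin N),
      (fun i => select i (List.ofFn ((Prod.map g id ∘ j) ∘ σ)))
        = fun i => (select i (List.ofFn (j ∘ σ))).map g := by
    intro σ
    funext i
    rw [← select_map, List.map_ofFn]
    rfl
  simp_rw [hstep]
  set E := ∀ i, Equiv.Perm (Fin (n i))
  -- Permuting the tokens inside each label permutes `J`, hence amounts to a translation of `σ`.
  have hinv : ∀ e : E, ∑ σ : Equiv.Perm (Fin N), φ (fun i => (select i (List.ofFn (j ∘ σ))).map g)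
      = ∑ σ : Equiv.Perm (Fin N), φ (fun i => (select i (List.ofFn (j ∘ σ))).map
          (g ∘ Sigma.map id fun i => e i)) := by
    intro e
    have hperm : (List.ofFn (Prod.map (Sigma.map id fun i => e i) id ∘ j)).Perm (List.ofFn j) := by
      rw [← List.map_ofFn, ← hj, hJ, tagAll_map]
      refine tagAll_perm fun i => ?_
      rw [List.map_ofFn]
      exact (e i).ofFn_comp_perm fun k : Fin (n i) => (⟨i, k⟩ : Σ i, Fin (n i))
    obtain ⟨τ, hτ⟩ := perm_ofFn_iff.1 hperm
    have hτ' : Prod.map (Sigma.map id fun i => e i) id ∘ j = j ∘ τ := List.ofFn_injective hτ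
    rw [← Fintype.sum_equiv (Equiv.mulLeft τ) (fun σ => φ fun i =>
      (select i (List.ofFn (j ∘ (τ * σ : Equiv.Perm (Fin N))))).map g) _ fun σ => rfl]
    refine Finset.sum_congr rfl fun σ _ => congrArg φ (funext fun i => ?_)
    rw [Equiv.Perm.coe_mul, ← Function.comp_assoc, ← hτ', Function.comp_assoc, ← List.map_ofFn,
      select_map, List.map_map]
  -- For fixed `σ` the selected tokens of label `i` are some permutation of all tokens of that
  -- label, which the sum over `e` absorbs.
  have hfix : ∀ σ : Equiv.Perm (Fin N),
      ∑ e : E, φ (fun i => (select i (List.ofFn (j ∘ σ))).map (g ∘ Sigma.map id fun i => e i))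
        = ∑ e : E, φ fun i => List.ofFn (f i ∘ e i) := by
    intro σ
    have hs : ∀ i, ∃ τ : Equiv.Perm (Fin (n i)),
        select i (List.ofFn (j ∘ σ)) = List.ofFn ((fun k : Fin (n i) => (⟨i, k⟩ : Σ i, Fin (n i))) ∘ τ) := by
      intro i
      refine perm_ofFn_iff.1 ((select_perm i (σ.ofFn_comp_perm j)).trans ?_)
      rw [← hj, hJ, select_tagAll]
    choose τ hτ using hs
    refine Fintype.sum_equiv (Equiv.mulRight (τ : E)) _ _ fun e => congrArg φ (funext fun i => ?_)
    rw [hτ, List.map_ofFn]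
    rfl
  -- The double sum over `e` and `σ`, evaluated in both orders.
  have hmul : (Fintype.card E : ℝ≥0∞) *
      ∑ σ : Equiv.Perm (Fin N), φ (fun i => (select i (List.ofFn (j ∘ σ))).map g)
        = N.factorial * ∑ e : E, φ fun i => List.ofFn (f i ∘ e i) := by
    calc _ = ∑ e : E, ∑ σ : Equiv.Perm (Fin N),
          φ (fun i => (select i (List.ofFn (j ∘ σ))).map (g ∘ Sigma.map id fun i => e i)) := by
            rw [← Finset.sum_congr rfl fun e _ => hinv e, Finset.sum_const, Finset.card_univ,
              nsmul_eq_mul]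
      _ = _ := by
            rw [Finset.sum_comm, Finset.sum_congr rfl fun σ _ => hfix σ, Finset.sum_const,
              Finset.card_univ, nsmul_eq_mul, Fintype.card_perm, Fintype.card_fin]
  have hE : (Fintype.card E : ℝ≥0∞) ≠ 0 := by exact_mod_cast Fintype.card_ne_zero
  have hN : (N.factorial : ℝ≥0∞) ≠ 0 := by exact_mod_cast N.factorial_ne_zero
  calc _ = (N.factorial : ℝ≥0∞)⁻¹ * ((Fintype.card E : ℝ≥0∞)⁻¹ * ((Fintype.card E : ℝ≥0∞) *
        ∑ σ : Equiv.Perm (Fin N), φ (fun i => (select i (List.ofFn (j ∘ σ))).map g))) := by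
        rw [ENNReal.inv_mul_cancel_left hE (ENNReal.natCast_ne_top _)]
    _ = (Fintype.card E : ℝ≥0∞)⁻¹ * ((N.factorial : ℝ≥0∞)⁻¹ * (N.factorial *
        ∑ e : E, φ fun i => List.ofFn (f i ∘ e i))) := by rw [hmul]; ring
    _ = _ := by rw [ENNReal.inv_mul_cancel_left hN (ENNReal.natCast_ne_top _)]

end Pi

lemma lintegral_lintegral_shuffle (l : List M) {φ : List M → ℝ≥0∞} (hφ : Measurable φ) :
    ∫⁻ l', ∫⁻ l'', φ l'' ∂shuffle M l' ∂shuffle M l = ∫⁻ l', φ l' ∂shuffle M l := by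
  have hm : Measurable fun l' => ∫⁻ l'', φ l'' ∂shuffle M l' := hφ.lintegral_kernel
  conv_lhs => rw [← List.ofFn_get l]
  rw [lintegral_shuffle_ofFn _ hm]
  have h : ∀ σ : Equiv.Perm (Fin l.length), shuffle M (List.ofFn (l.get ∘ σ)) = shuffle M l :=
    fun σ => shuffle_eq_of_perm ((σ.ofFn_comp_perm _).trans (by rw [List.ofFn_get]))
  simp_rw [h]
  rw [Finset.sum_const, Finset.card_univ, nsmul_eq_mul, Fintype.card_perm, Fintype.card_fin,
    ENNReal.inv_mul_cancel_left (by exact_mod_cast l.length.factorial_ne_zero)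
      (ENNReal.natCast_ne_top _)]

end Shuffle

/-! ### Products over pairs of indices, and two-stage sampling -/

section PiMeasure

variable {ι κ : Type*} [Fintype ι] [Fintype κ]

lemma pi_map_curry {X : Type*} [MeasurableSpace X] (μ : ι → κ → Measure X)
    [∀ i j, IsProbabilityMeasure (μ i j)] :
    (Measure.pi fun p : ι × κ => μ p.1 p.2).map (fun x i j => x (i, j))
      = Measure.pi fun i => Measure.pi (μ i) := by
  have h := Measure.infinitePi_map_curry μ
  simp only [Measure.infinitePi_eq_pi] at h
  exact h

lemma pi_map_swap {X : Type*} [MeasurableSpace X] (μ : ι → κ → Measure X)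
    [∀ i j, IsProbabilityMeasure (μ i j)] :
    (Measure.pi fun i => Measure.pi (μ i)).map (fun x j i => x i j)
      = Measure.pi fun j => Measure.pi fun i => μ i j := by
  have hswap : (Measure.pi fun p : ι × κ => μ p.1 p.2).map (fun x (q : κ × ι) => x q.swap)
      = Measure.pi fun q : κ × ι => μ q.2 q.1 := by
    refine (Measure.pi_eq fun s hs => ?_).symm
    rw [Measure.map_apply (by fun_prop) (.univ_pi hs)]
    have : (fun (x : ι × κ → X) (q : κ × ι) => x q.swap) ⁻¹' Set.univ.pi s
        = Set.univ.pi fun p : ι × κ => s p.swap := by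
      ext x
      simp only [Set.mem_preimage, Set.mem_pi, Set.mem_univ, forall_const, Prod.forall,
        Prod.swap_prod_mk]
      exact forall_comm
    rw [this, Measure.pi_pi]
    exact Fintype.prod_equiv (Equiv.prodComm ι κ) _ _ fun p => rfl
  rw [← pi_map_curry μ, ← pi_map_curry fun j i => μ i j, ← hswap,
    Measure.map_map (by fun_prop) (by fun_prop), Measure.map_map (by fun_prop) (by fun_prop)]
  rfl

variable {α β : ι → Type*} [∀ i, MeasurableSpace (α i)] [∀ i, MeasurableSpace (β i)]

/-- Independent pairs may be drawn by first drawing all first components; this regroups seeds with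
shuffler outputs, and function pairs with estimates. -/
lemma lintegral_pi_compProd (μ : ∀ i, Measure (α i)) [∀ i, IsProbabilityMeasure (μ i)]
    (κ : ∀ i, Kernel (α i) (β i)) [∀ i, IsMarkovKernel (κ i)]
    {Ψ : (∀ i, α i) × (∀ i, β i) → ℝ≥0∞} (hΨ : Measurable Ψ) :
    ∫⁻ v, Ψ (fun i => (v i).1, fun i => (v i).2) ∂Measure.pi (fun i => μ i ⊗ₘ κ i)
      = ∫⁻ a, ∫⁻ b, Ψ (a, b) ∂Measure.pi (fun i => κ i (a i)) ∂Measure.pi μ := by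
  have h1 : Measure.pi (fun i => μ i ⊗ₘ κ i) = (Measure.pi μ).bind
      (piKernel fun i => (Kernel.id ×ₖ κ i).comap (fun a : ∀ i, α i => a i)
        (measurable_pi_apply i)) := by
    simp_rw [Measure.compProd_eq_comp_prod]
    exact (pi_bind μ fun i => (Kernel.id ×ₖ κ i).measurable).symm
  rw [h1, Measure.lintegral_bind (Kernel.aemeasurable _) (by fun_prop)]
  refine lintegral_congr fun a => ?_
  have h2 : (piKernel fun i => (Kernel.id ×ₖ κ i).comap (fun a : ∀ i, α i => a i)
        (measurable_pi_apply i)) a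
      = (Measure.pi fun i => κ i (a i)).map fun b i => (a i, b i) := by
    have : ∀ i, IsProbabilityMeasure ((κ i (a i)).map (Prod.mk (a i))) :=
      fun i => Measure.isProbabilityMeasure_map (by fun_prop)
    rw [Measure.pi_map_pi (f := fun i b => (a i, b)) fun i => by fun_prop]
    change Measure.pi (fun i => (Kernel.id ×ₖ κ i) (a i)) = _
    congr 1
    funext i
    rw [Kernel.prod_apply, Kernel.id_apply, Measure.dirac_prod]
  rw [h2, lintegral_map (by fun_prop) (by fun_prop)]

end PiMeasure

/-! ### A user's labelled messages -/

section Randomizer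

variable {W M ι : Type*} [MeasurableSpace W] [MeasurableSpace M] [MeasurableSpace ι] [Fintype ι]

lemma discretizedRandomizer_apply {m : ℕ} (disc : Kernel W (ι → Fin m)) [IsMarkovKernel disc]
    (enc : ι → Fin m → Kernel W (List M)) [∀ i v, IsMarkovKernel (enc i v)] {w : W}
    {β : ι → Measure (Fin m)} [∀ i, IsProbabilityMeasure (β i)] (hβ : disc w = Measure.pi β) :
    discretizedRandomizer disc enc w
      = (Measure.pi fun i => (β i).bind fun b => enc i b w).map tagAll := by
  have hpi : Measure.pi (fun i => (β i).bind fun b => enc i b w)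
      = (Measure.pi β).bind fun v => encodeAll enc (w, v) :=
    (pi_bind β fun i => measurable_of_countable fun b => enc i b w).symm
  refine Measure.ext_of_lintegral _ fun φ hφ => ?_
  have ht : Measurable (tagAll : (ι → List M) → List (M × ι)) := measurable_tagAll
  rw [discretizedRandomizer, Kernel.lintegral_map _ (by fun_prop) _ hφ,
    Kernel.lintegral_compProd _ _ _ (by fun_prop), hβ, lintegral_map hφ ht, hpi,
    Measure.lintegral_bind (measurable_of_countable _).aemeasurable (by fun_prop)]

omit [MeasurableSpace M] [MeasurableSpace ι] in
-- Listing by user or by label gives the same multiset, which is all that a shuffler sees.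
lemma flatten_tagAll_perm {n : ℕ} (Γ : Fin n → ι → List M) :
    (List.ofFn fun u => tagAll (Γ u)).flatten.Perm
      (tagAll fun i => (List.ofFn fun u => Γ u i).flatten) := by
  classical
  have h1 : ∀ (L : List (Fin n)) (K : List ι),
      (L.flatMap fun u => K.flatMap fun i => (Γ u i).map fun γ => (γ, i)).Perm
        (K.flatMap fun i => L.flatMap fun u => (Γ u i).map fun γ => (γ, i)) := by
    intro L K
    induction L with
    | nil => simp
    | cons u L ih =>
      simp only [List.flatMap_cons]
      exact (ih.append_left _).trans (List.flatMap_append_perm K _ _)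
  have h2 := h1 (List.finRange n) Finset.univ.toList
  simpa only [tagAll, List.ofFn_eq_map, ← List.flatMap_def, List.map_flatMap] using h2

end Randomizer

/-! ### Views on random bits -/

section View

variable {W M : Type*} [MeasurableSpace W] [MeasurableSpace M] {n : ℕ}

lemma Protocol.shuffled_apply {X Out : Type*} [MeasurableSpace Out] (P : Protocol X W M Out)
    (D : Fin n → X) (w : W) :
    P.shuffled D w = ((Measure.pi fun u => P.randomizer (D u) w).map
      fun m : Fin n → List M => (List.ofFn m).flatten).bind (shuffle M) := by
  rw [Protocol.shuffled, Kernel.comp_apply, Kernel.map_apply _ (measurable_flatten_ofFn n)]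
  rfl

instance {X Out : Type*} [MeasurableSpace Out] (P : Protocol X W M Out) (D : Fin n → X) :
    IsMarkovKernel (P.shuffled D) := by
  have : IsMarkovKernel ((piKernel fun u => P.randomizer (D u)).map
      fun m : Fin n → List M => (List.ofFn m).flatten) :=
    Kernel.IsMarkovKernel.map _ (measurable_flatten_ofFn n)
  exact inferInstanceAs (IsMarkovKernel (_ ∘ₖ _))

instance {X Out : Type*} [MeasurableSpace Out] (P : Protocol X W M Out) (D : Fin n → X) :
    IsProbabilityMeasure (P.view D) :=
  inferInstanceAs (IsProbabilityMeasure (P.seed ⊗ₘ P.shuffled D))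

instance {X Out : Type*} [MeasurableSpace Out] (P : Protocol X W M Out) (D : Fin n → X) :
    IsProbabilityMeasure (P.output D) :=
  Measure.isProbabilityMeasure_map (by fun_prop)

/-- The law of the shuffler's output on independent random bits. -/
def mixedShuffled (P : Protocol (Fin 2) W M ℝ) (p : Fin n → unitInterval) : Kernel W (List M) where
  toFun w := (bits p).bind fun b => P.shuffled b w
  measurable' := by
    refine Measure.measurable_of_measurable_coe _ fun s hs => ?_
    simp_rw [Measure.bind_apply hs (measurable_of_countable _).aemeasurable]
    refine Measurable.lintegral_prod_right' (f := fun q : W × (Fin n → Fin 2) =>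
      P.shuffled q.2 q.1 s) ?_
    exact measurable_from_prod_countable_left fun b => (P.shuffled b).measurable_coe hs

instance (P : Protocol (Fin 2) W M ℝ) (p : Fin n → unitInterval) :
    IsMarkovKernel (mixedShuffled P p) :=
  ⟨fun w => inferInstanceAs (IsProbabilityMeasure ((bits p).bind fun b => P.shuffled b w))⟩

/-- The bits are independent of the public randomness, so Tonelli exchanges the two draws. -/
lemma seed_compProd_mixedShuffled (P : Protocol (Fin 2) W M ℝ) (p : Fin n → unitInterval) :
    P.seed ⊗ₘ mixedShuffled P p = (bits p).bind P.view := by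
  refine Measure.ext_of_lintegral _ fun φ hφ => ?_
  rw [Measure.lintegral_compProd hφ,
    Measure.lintegral_bind (measurable_of_countable _).aemeasurable hφ.aemeasurable]
  have h1 : ∀ w, ∫⁻ l, φ (w, l) ∂mixedShuffled P p w
      = ∫⁻ b, ∫⁻ l, φ (w, l) ∂P.shuffled b w ∂bits p := fun w =>
    Measure.lintegral_bind (measurable_of_countable _).aemeasurable (by fun_prop)
  simp_rw [h1]
  rw [lintegral_lintegral_swap]
  · refine lintegral_congr fun b => ?_
    rw [Protocol.view, Measure.lintegral_compProd hφ]
  · refine Measurable.aemeasurable ?_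
    refine measurable_from_prod_countable_left fun b => ?_
    exact hφ.lintegral_kernel_prod_right' (κ := P.shuffled b)

/-- The bits' randomness can be moved into the randomizers. -/
lemma mixedShuffled_apply (P : Protocol (Fin 2) W M ℝ) (p : Fin n → unitInterval) (w : W) :
    mixedShuffled P p w = ((Measure.pi fun u =>
        (bernoulliMeasure 1 0 (p u)).bind fun b => P.randomizer b w).map
      fun m : Fin n → List M => (List.ofFn m).flatten).bind (shuffle M) := by
  have hpi : Measure.pi (fun u => (bernoulliMeasure 1 0 (p u)).bind fun b => P.randomizer b w)
      = (bits p).bind fun b => Measure.pi fun u => P.randomizer (b u) w :=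
    (pi_bind _ fun u => measurable_of_countable fun b => P.randomizer b w).symm
  have hf := measurable_flatten_ofFn (M := M) n
  refine Measure.ext_of_lintegral _ fun φ hφ => ?_
  have hs : Measurable fun l => ∫⁻ l', φ l' ∂shuffle M l := hφ.lintegral_kernel
  have hsf : Measurable fun m : Fin n → List M => ∫⁻ l', φ l' ∂shuffle M (List.ofFn m).flatten :=
    hs.comp hf
  change ∫⁻ l, φ l ∂((bits p).bind fun b => P.shuffled b w) = _
  rw [Measure.lintegral_bind (measurable_of_countable _).aemeasurable hφ.aemeasurable,
    Measure.lintegral_bind (Kernel.aemeasurable _) hφ.aemeasurable, lintegral_map hs hf, hpi,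
    Measure.lintegral_bind (measurable_of_countable _).aemeasurable hsf.aemeasurable]
  refine lintegral_congr fun b => ?_
  rw [Protocol.shuffled_apply, Measure.lintegral_bind (Kernel.aemeasurable _) hφ.aemeasurable,
    lintegral_map hs hf]

end View

/-! ### The adversary's view as a function of independent instances -/

section KDE

variable {d Q n I : ℕ} {R : ℝ} {Ω W M : Type*} [MeasurableSpace Ω] [MeasurableSpace W]
  [MeasurableSpace M] (𝒬 : FunctionPairDist d Q R Ω) (P : Protocol (Fin 2) W M ℝ)
  (D : Fin n → EuclideanSpace ℝ (Fin d))

/-- The rounding probabilities of all users, for one pair of functions and one coordinate. -/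
def roundingProbs (ω : Ω) (j : Fin Q) : Fin n → unitInterval :=
  fun u => roundingProb 𝒬 ω (D u) j

/-- Given `w`, the message lists are independent over users and over instances, so they can be
regrouped by instance. The global shuffle ignores the order of its input, hence each instance may be
shuffled beforehand at no cost; this is what makes the instances' own shuffler outputs appear. -/
lemma lintegral_kdeProtocol_shuffled (w : KDESeed I Q Ω W)
    {φ : List (M × (Fin I × Fin Q)) → ℝ≥0∞} (hφ : Measurable φ) :
    ∫⁻ l, φ l ∂(kdeProtocol n I 𝒬 P).shuffled D w
      = ∫⁻ Γ, ∫⁻ l, φ l ∂shuffle _ (tagAll Γ)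
          ∂Measure.pi fun ij : Fin I × Fin Q =>
            mixedShuffled P (roundingProbs 𝒬 D (w.1 ij.1) ij.2) (w.2 ij) := by
  set ρ : Fin n → Fin I × Fin Q → Measure (List M) := fun u ij =>
    (bernoulliMeasure 1 0 (roundingProb 𝒬 (w.1 ij.1) (D u) ij.2)).bind
      fun b => P.randomizer b (w.2 ij) with hρ
  have hρprob : ∀ u ij, IsProbabilityMeasure (ρ u ij) := fun u ij =>
    isProbabilityMeasure_bind (measurable_of_countable _).aemeasurable (.of_forall inferInstance)
  have hrand : ∀ u, (kdeProtocol n I 𝒬 P).randomizer (D u) w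
      = (Measure.pi (ρ u)).map tagAll := fun u =>
    discretizedRandomizer_apply (rounding I 𝒬 W (D u)) (instanceRandomizer I P Ω)
      (β := fun ij => bernoulliMeasure 1 0 (roundingProb 𝒬 (w.1 ij.1) (D u) ij.2)) rfl
  have ht : Measurable (tagAll : (Fin I × Fin Q → List M) → List (M × (Fin I × Fin Q))) :=
    measurable_tagAll
  have hf := measurable_flatten_ofFn (M := M) n
  have hf' := measurable_flatten_ofFn (M := M × (Fin I × Fin Q)) n
  have hs : Measurable fun l => ∫⁻ l', φ l' ∂shuffle (M × (Fin I × Fin Q)) l :=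
    hφ.lintegral_kernel
  have hsf' : Measurable fun m : Fin n → List (M × (Fin I × Fin Q)) =>
      ∫⁻ l', φ l' ∂shuffle (M × (Fin I × Fin Q)) (List.ofFn m).flatten := hs.comp hf'
  have htag : ∀ u, IsProbabilityMeasure ((Measure.pi (ρ u)).map tagAll) := fun u =>
    Measure.isProbabilityMeasure_map ht.aemeasurable
  have hflat : ∀ ij, IsProbabilityMeasure ((Measure.pi fun u => ρ u ij).map
      fun m : Fin n → List M => (List.ofFn m).flatten) := fun ij =>
    Measure.isProbabilityMeasure_map hf.aemeasurable
  rw [Protocol.shuffled_apply, Measure.lintegral_bind (Kernel.aemeasurable _) hφ.aemeasurable,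
    lintegral_map hs hf']
  simp_rw [hrand]
  rw [← Measure.pi_map_pi (f := fun _ => tagAll) fun _ => ht.aemeasurable,
    lintegral_map hsf' (by fun_prop)]
  have hperm : ∀ Γ : Fin n → Fin I × Fin Q → List M,
      shuffle (M × (Fin I × Fin Q)) (List.ofFn fun u => tagAll (Γ u)).flatten
        = shuffle _ (tagAll fun ij => (List.ofFn fun u => Γ u ij).flatten) := fun Γ =>
    shuffle_eq_of_perm (flatten_tagAll_perm Γ)
  simp_rw [hperm]
  have hH : Measurable fun Γ : Fin I × Fin Q → List M => ∫⁻ l, φ l ∂shuffle _ (tagAll Γ) :=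
    hs.comp ht
  have hflatAll : Measurable fun (G : Fin I × Fin Q → Fin n → List M) (ij : Fin I × Fin Q) =>
      (List.ofFn (G ij)).flatten :=
    measurable_pi_lambda _ fun ij => hf.comp (measurable_pi_apply ij)
  have hmix : Measure.pi (fun ij : Fin I × Fin Q =>
        mixedShuffled P (roundingProbs 𝒬 D (w.1 ij.1) ij.2) (w.2 ij))
      = (Measure.pi fun ij => (Measure.pi fun u => ρ u ij).map
          fun m : Fin n → List M => (List.ofFn m).flatten).bind
          (piKernel fun ij => (shuffle M).comap (fun Γ : Fin I × Fin Q → List M => Γ ij)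
            (measurable_pi_apply ij)) := by
    refine Eq.trans ?_ (pi_bind _ fun _ => (shuffle M).measurable).symm
    congr 1
    funext ij
    exact mixedShuffled_apply P _ _
  have hHf : Measurable fun G : Fin I × Fin Q → Fin n → List M =>
      ∫⁻ l, φ l ∂shuffle _ (tagAll fun ij => (List.ofFn (G ij)).flatten) := hH.comp hflatAll
  rw [hmix, Measure.lintegral_bind (Kernel.aemeasurable _) hH.aemeasurable]
  -- The preliminary shuffles inside the instances are absorbed by the global one.
  have hinv : ∀ Γ : Fin I × Fin Q → List M, ∫⁻ Λ, ∫⁻ l, φ l ∂shuffle _ (tagAll Λ)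
      ∂(piKernel fun ij => (shuffle M).comap (fun Γ : Fin I × Fin Q → List M => Γ ij)
            (measurable_pi_apply ij)) Γ = ∫⁻ l, φ l ∂shuffle _ (tagAll Γ) := fun Γ =>
    lintegral_pi_shuffle_of_invariant Γ hH fun Λ hΛ => by
      rw [shuffle_eq_of_perm (tagAll_perm hΛ)]
  simp_rw [hinv]
  rw [← Measure.pi_map_pi (f := fun _ (m : Fin n → List M) => (List.ofFn m).flatten)
    fun _ => hf.aemeasurable, lintegral_map hH hflatAll, ← pi_map_swap ρ,
    lintegral_map hHf (by fun_prop)]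

/-- The law of the bitsum instance's view on the randomly rounded coordinate. -/
def roundedView (ω : Ω) (j : Fin Q) : Measure (W × List M) :=
  (bits (roundingProbs 𝒬 D ω j)).bind P.view

instance (ω : Ω) (j : Fin Q) : IsProbabilityMeasure (roundedView 𝒬 P D ω j) :=
  inferInstanceAs (IsProbabilityMeasure ((bits _).bind P.view))

/-- Given the pairs of functions, the adversary's view is a post-processing of independent views
of the bitsum instances. -/
theorem lintegral_kdeProtocol_view {φ : KDESeed I Q Ω W × List (M × (Fin I × Fin Q)) → ℝ≥0∞}
    (hφ : Measurable φ) :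
    ∫⁻ p, φ p ∂(kdeProtocol n I 𝒬 P).view D
      = ∫⁻ ω, ∫⁻ v, ∫⁻ l, φ ((ω, fun ij => (v ij).1), l) ∂shuffle _ (tagAll fun ij => (v ij).2)
          ∂(Measure.pi fun ij : Fin I × Fin Q => roundedView 𝒬 P D (ω ij.1) ij.2)
          ∂(Measure.pi fun _ => 𝒬.law) := by
  rw [Protocol.view, Measure.lintegral_compProd hφ]
  change ∫⁻ w, ∫⁻ l, φ (w, l) ∂(kdeProtocol n I 𝒬 P).shuffled D w
    ∂((Measure.pi fun _ => 𝒬.law).prod (Measure.pi fun _ => P.seed)) = _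
  rw [lintegral_prod _ (hφ.lintegral_kernel_prod_right').aemeasurable]
  refine lintegral_congr fun ω => ?_
  have hsh : ∀ w' : Fin I × Fin Q → W,
      ∫⁻ l, φ ((ω, w'), l) ∂(kdeProtocol n I 𝒬 P).shuffled D (ω, w')
        = ∫⁻ Γ, ∫⁻ l, φ ((ω, w'), l) ∂shuffle _ (tagAll Γ)
          ∂Measure.pi fun ij : Fin I × Fin Q =>
            mixedShuffled P (roundingProbs 𝒬 D (ω ij.1) ij.2) (w' ij) := fun w' =>
    lintegral_kdeProtocol_shuffled 𝒬 P D (ω, w') (hφ.comp measurable_prodMk_left)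
  simp_rw [hsh, roundedView, ← seed_compProd_mixedShuffled]
  have ht : Measurable (tagAll : (Fin I × Fin Q → List M) → List (M × (Fin I × Fin Q))) :=
    measurable_tagAll
  have hΨ : Measurable fun q : (Fin I × Fin Q → W) × (Fin I × Fin Q → List M) =>
      ∫⁻ l, φ ((ω, q.1), l) ∂shuffle _ (tagAll q.2) := by
    have := Measurable.lintegral_kernel_prod_right'
      (κ := (shuffle (M × (Fin I × Fin Q))).comap
        (fun q : (Fin I × Fin Q → W) × (Fin I × Fin Q → List M) => tagAll q.2) (by fun_prop))
      (f := fun q => φ ((ω, q.1.1), q.2)) (by fun_prop)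
    exact this
  exact (lintegral_pi_compProd (fun _ => P.seed)
    (fun ij : Fin I × Fin Q => mixedShuffled P (roundingProbs 𝒬 D (ω ij.1) ij.2)) hΨ).symm

end KDE

/-! ### Privacy of the view and of the output -/

section Privacy

lemma Close.map {α β : Type*} [MeasurableSpace α] [MeasurableSpace β] {P Q : Measure α} {c : ℝ≥0}
    {δ : ℝ≥0∞} (h : Close c δ P Q) {f : α → β} (hf : Measurable f) :
    Close c δ (P.map f) (Q.map f) := fun A hA => by
  rw [Measure.map_apply hf hA, Measure.map_apply hf hA]
  exact h _ (hf hA)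

lemma pi_map_uncurry {ι κ X : Type*} [Fintype ι] [Fintype κ] [MeasurableSpace X]
    (μ : ι → κ → Measure X) [∀ i j, IsProbabilityMeasure (μ i j)] :
    (Measure.pi fun i => Measure.pi (μ i)).map (fun x (p : ι × κ) => x p.1 p.2)
      = Measure.pi fun p : ι × κ => μ p.1 p.2 := by
  rw [← pi_map_curry, Measure.map_map (by fun_prop) (by fun_prop)]
  exact Measure.map_id

lemma Neighboring.exists_forall_ne {n : ℕ} {X : Type*} {D D' : Fin n → X} (hn : 0 < n)
    (h : Neighboring D D') : ∃ u, ∀ v, v ≠ u → D v = D' v := by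
  by_cases hD : ∃ u, D u ≠ D' u
  · obtain ⟨u, hu⟩ := hD
    exact ⟨u, fun v hv => by_contra fun hne => hv (h hne hu)⟩
  · push Not at hD
    exact ⟨⟨0, hn⟩, fun v _ => hD v⟩

lemma neighboring_update {n : ℕ} {X : Type*} (x : Fin n → X) (u : Fin n) (a b : X) :
    Neighboring (Function.update x u a) (Function.update x u b) := by
  have h : ∀ v, Function.update x u a v ≠ Function.update x u b v → v = u := fun v hv => by
    by_contra hne
    exact hv (by rw [Function.update_of_ne hne, Function.update_of_ne hne])
  exact fun v hv v' hv' => (h v hv).trans (h v' hv').symm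

/-- Given the view, the probability that the output lands in `A` is a `[0,1]`-valued test function.
-/
lemma Close.output {X W M Out : Type*} [MeasurableSpace W] [MeasurableSpace M]
    [MeasurableSpace Out] {P : Protocol X W M Out} {n : ℕ} {D D' : Fin n → X} {c : ℝ≥0} {δ : ℝ≥0∞}
    (h : Close c δ (P.view D) (P.view D')) : Close c δ (P.output D) (P.output D') := by
  intro A hA
  have hm : Measurable fun p : (W × List M) × Out => (p.1.1, p.2) := by fun_prop
  rw [Protocol.output, Protocol.output, Measure.map_apply hm hA, Measure.map_apply hm hA,
    Measure.compProd_apply (hm hA), Measure.compProd_apply (hm hA)]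
  exact h.lintegral_le fun p => prob_le_one

variable {d Q S n I : ℕ} {R : ℝ} {Ω W M : Type*} [MeasurableSpace Ω] [MeasurableSpace W]
  [MeasurableSpace M]

lemma card_roundingProbs_ne_le (𝒬 : FunctionPairDist d Q R Ω)
    (h : ∀ ω x, (Finset.univ.filter fun j => 𝒬.f ω x j ≠ 0).card ≤ S)
    (D : Fin n → EuclideanSpace ℝ (Fin d)) (ω : Ω) (u : Fin n) :
    (Finset.univ.filter fun j => (roundingProbs 𝒬 D ω j u : ℝ) ≠ 1 / 2).card ≤ S := by
  refine (Finset.card_le_card fun j hj => ?_).trans (h ω (D u))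
  rw [Finset.mem_filter] at hj ⊢
  refine ⟨Finset.mem_univ _, fun h0 => hj.2 ?_⟩
  change (1 + 𝒬.f ω (D u) j / R) / 2 = 1 / 2
  rw [h0]
  simp

/-- For fixed pairs, the `Q` coordinates of one pair form a block treated by `close_pi_bits_bind`,
and the `I` blocks are composed by `Close.pi_advanced`. Labelling and shuffling is post-processing,
and the law of the pairs does not depend on the data. -/
theorem close_kdeProtocol_view {ε₀ δ₀ δ' : ℝ} (hn : 0 < n) (hI : 0 < I) (hε₀ : 0 ≤ ε₀)
    (hδ₀ : 0 ≤ δ₀) (hδ' : 0 < δ') (𝒬 : FunctionPairDist d Q R Ω)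
    (h𝒬 : ∀ ω x, (Finset.univ.filter fun j => 𝒬.f ω x j ≠ 0).card ≤ S)
    (P : Protocol (Fin 2) W M ℝ) (hDP : IsDP (n := n) ε₀ δ₀ P.view)
    {D D' : Fin n → EuclideanSpace ℝ (Fin d)} (hD : Neighboring D D') :
    Close (Real.exp (ε₀ * S * (Real.exp (ε₀ * S) - 1) * I
        + ε₀ * S * Real.sqrt (2 * I * Real.log (1 / δ')))).toNNReal
      (ENNReal.ofReal (I * S * δ₀ + δ'))
      ((kdeProtocol n I 𝒬 P).view D) ((kdeProtocol n I 𝒬 P).view D') := by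
  obtain ⟨u, hu⟩ := hD.exists_forall_ne hn
  have : Nonempty (Fin I) := ⟨⟨0, hI⟩⟩
  have hV : ∀ (x : Fin n → Fin 2) (a b : Fin 2), Close (Real.exp ε₀).toNNReal (ENNReal.ofReal δ₀)
      (P.view (Function.update x u a)) (P.view (Function.update x u b)) := fun x a b =>
    (close_iff_real (Real.exp_pos _).le hδ₀).2 (hDP _ _ (neighboring_update x u a b))
  have hblock : ∀ {E E' : Fin n → EuclideanSpace ℝ (Fin d)}, (∀ v, v ≠ u → E v = E' v) →
      ∀ ω : Ω, Close (Real.exp (ε₀ * S)).toNNReal (ENNReal.ofReal (S * δ₀))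
        (Measure.pi (roundedView 𝒬 P E ω)) (Measure.pi (roundedView 𝒬 P E' ω)) := by
    intro E E' hE ω
    exact close_pi_bits_bind hε₀ hδ₀ hV
      (fun j v hv => by simp only [roundingProbs, hE v hv])
      (card_roundingProbs_ne_le 𝒬 h𝒬 E ω u) (card_roundingProbs_ne_le 𝒬 h𝒬 E' ω u)
  have hδeq : (Fintype.card (Fin I) : ℝ≥0∞) * ENNReal.ofReal (S * δ₀) + ENNReal.ofReal δ'
      = ENNReal.ofReal (I * S * δ₀ + δ') := by
    rw [ENNReal.ofReal_add (by positivity) hδ'.le, mul_assoc, ENNReal.ofReal_mul (Nat.cast_nonneg I),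
      ENNReal.ofReal_natCast, Fintype.card_fin]
  have hω : ∀ ω : Fin I → Ω, Close (Real.exp (ε₀ * S * (Real.exp (ε₀ * S) - 1) * I
        + ε₀ * S * Real.sqrt (2 * I * Real.log (1 / δ')))).toNNReal
      (ENNReal.ofReal (I * S * δ₀ + δ'))
      (Measure.pi fun ij : Fin I × Fin Q => roundedView 𝒬 P D (ω ij.1) ij.2)
      (Measure.pi fun ij : Fin I × Fin Q => roundedView 𝒬 P D' (ω ij.1) ij.2) := by
    intro ω
    rw [← pi_map_uncurry fun i j => roundedView 𝒬 P D (ω i) j,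
      ← pi_map_uncurry fun i j => roundedView 𝒬 P D' (ω i) j]
    refine Close.map ?_ (by fun_prop)
    have := Close.pi_advanced (ι := Fin I) (mul_nonneg hε₀ (Nat.cast_nonneg S)) hδ'
      (fun i => hblock hu (ω i)) (fun i => hblock (fun v hv => (hu v hv).symm) (ω i))
    rwa [hδeq, Fintype.card_fin] at this
  intro A hA
  rw [← lintegral_indicator_one hA, ← lintegral_indicator_one hA,
    lintegral_kdeProtocol_view 𝒬 P D (measurable_one.indicator hA),
    lintegral_kdeProtocol_view 𝒬 P D' (measurable_one.indicator hA)]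
  refine (lintegral_mono fun ω => (hω ω).lintegral_le fun v => ?_).trans ?_
  · refine (lintegral_mono (g := fun _ => 1) fun l => ?_).trans (by simp)
    exact Set.indicator_apply_le' (fun _ => le_rfl) fun _ => zero_le_one
  · rw [lintegral_add_right _ measurable_const, lintegral_const_mul' _ _ ENNReal.coe_ne_top]
    simp

end Privacy

/-! ### Independence of the instances' estimates -/

section Output

variable {d Q n I : ℕ} {R : ℝ} {Ω W M : Type*} [MeasurableSpace Ω] [MeasurableSpace W]
  [MeasurableSpace M] (𝒬 : FunctionPairDist d Q R Ω) (P : Protocol (Fin 2) W M ℝ)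
  (D : Fin n → EuclideanSpace ℝ (Fin d))

lemma lintegral_lintegral_shuffle_view {X Out : Type*} [MeasurableSpace Out]
    (P : Protocol X W M Out) (D : Fin n → X) {φ : W × List M → ℝ≥0∞} (hφ : Measurable φ) :
    ∫⁻ p, ∫⁻ l, φ (p.1, l) ∂shuffle M p.2 ∂P.view D = ∫⁻ p, φ p ∂P.view D := by
  have hm : Measurable fun p : W × List M => ∫⁻ l, φ (p.1, l) ∂shuffle M p.2 := by
    have := Measurable.lintegral_kernel_prod_right'
      (κ := (shuffle M).comap (fun p : W × List M => p.2) measurable_snd)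
      (f := fun q => φ (q.1.1, q.2)) (by fun_prop)
    exact this
  rw [Protocol.view, Measure.lintegral_compProd hm, Measure.lintegral_compProd hφ]
  refine lintegral_congr fun w => ?_
  have hw : Measurable fun l => φ (w, l) := by fun_prop
  rw [Protocol.shuffled_apply, Measure.lintegral_bind (Kernel.aemeasurable _) hw.aemeasurable,
    Measure.lintegral_bind (Kernel.aemeasurable _) (hw.lintegral_kernel).aemeasurable]
  exact lintegral_congr fun l => lintegral_lintegral_shuffle l hw

lemma view_bind_analyzer {X Out : Type*} [MeasurableSpace Out] (P : Protocol X W M Out)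
    (D : Fin n → X) : (P.view D).bind P.analyzer = (P.output D).map Prod.snd := by
  rw [Protocol.output, Measure.map_map measurable_snd (by fun_prop), ← Measure.snd_compProd]
  rfl

/-- The law of the bitsum instance's estimate on the randomly rounded coordinate. -/
def roundedEstimate (ω : Ω) (j : Fin Q) : Measure ℝ :=
  (bits (roundingProbs 𝒬 D ω j)).bind fun b => (P.output b).map Prod.snd

instance (b : Fin n → Fin 2) : IsProbabilityMeasure ((P.output b).map Prod.snd) :=
  Measure.isProbabilityMeasure_map measurable_snd.aemeasurable

instance (ω : Ω) (j : Fin Q) : IsProbabilityMeasure (roundedEstimate 𝒬 P D ω j) :=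
  inferInstanceAs (IsProbabilityMeasure ((bits _).bind fun b => (P.output b).map Prod.snd))

lemma roundedView_bind_analyzer (ω : Ω) (j : Fin Q) :
    (roundedView 𝒬 P D ω j).bind P.analyzer = roundedEstimate 𝒬 P D ω j := by
  rw [roundedView, Measure.bind_bind (measurable_of_countable _).aemeasurable
    (Kernel.aemeasurable _), roundedEstimate]
  simp_rw [view_bind_analyzer]

/-- A view is already uniformly ordered given its seed, so reshuffling it while keeping the seed
changes nothing; this passes to mixtures over bits and to products. -/
lemma lintegral_pi_shuffle_roundedView (ω : Fin I → Ω)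
    {χ : (Fin I × Fin Q → W) × (Fin I × Fin Q → List M) → ℝ≥0∞} (hχ : Measurable χ) :
    ∫⁻ v, ∫⁻ Λ, χ (fun ij => (v ij).1, Λ) ∂Measure.pi (fun ij => shuffle M (v ij).2)
        ∂(Measure.pi fun ij : Fin I × Fin Q => roundedView 𝒬 P D (ω ij.1) ij.2)
      = ∫⁻ v, χ (fun ij => (v ij).1, fun ij => (v ij).2)
        ∂(Measure.pi fun ij : Fin I × Fin Q => roundedView 𝒬 P D (ω ij.1) ij.2) := by
  set T : Kernel (W × List M) (W × List M) :=
    Kernel.deterministic Prod.fst measurable_fst ×ₖ (shuffle M).comap Prod.snd measurable_snd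
  have hT : ∀ p : W × List M, T p = (shuffle M p.2).map (Prod.mk p.1) := fun p => by
    rw [Kernel.prod_apply, Kernel.deterministic_apply, Measure.dirac_prod]
    rfl
  have hTview : ∀ b : Fin n → Fin 2, (P.view b).bind T = P.view b := by
    intro b
    refine Measure.ext_of_lintegral _ fun φ hφ => ?_
    rw [Measure.lintegral_bind (Kernel.aemeasurable _) hφ.aemeasurable,
      ← lintegral_lintegral_shuffle_view P b hφ]
    refine lintegral_congr fun p => ?_
    rw [hT, lintegral_map hφ (by fun_prop)]
  have hTr : ∀ (ω : Ω) (j : Fin Q),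
      (roundedView 𝒬 P D ω j).bind T = roundedView 𝒬 P D ω j := by
    intro ω j
    rw [roundedView, Measure.bind_bind (measurable_of_countable _).aemeasurable
      (Kernel.aemeasurable _)]
    simp_rw [hTview]
  have hbind := pi_bind (fun ij : Fin I × Fin Q => roundedView 𝒬 P D (ω ij.1) ij.2)
    (κ := fun _ => T) fun _ => T.measurable
  simp_rw [hTr] at hbind
  conv_rhs => rw [← hbind]
  have hmeas : Measurable fun v : Fin I × Fin Q → W × List M => Measure.pi fun ij => T (v ij) :=
    measurable_measure_pi fun ij => T.measurable.comp (measurable_pi_apply ij)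
  rw [Measure.lintegral_bind hmeas.aemeasurable (by fun_prop)]
  refine lintegral_congr fun v => ?_
  have hpi : Measure.pi (fun ij => T (v ij))
      = (Measure.pi fun ij => shuffle M (v ij).2).map fun Λ ij => ((v ij).1, Λ ij) := by
    have : ∀ ij, IsProbabilityMeasure ((shuffle M (v ij).2).map (Prod.mk (v ij).1)) :=
      fun ij => Measure.isProbabilityMeasure_map (by fun_prop)
    rw [Measure.pi_map_pi (f := fun ij l => ((v ij).1, l)) fun ij => by fun_prop]
    simp_rw [hT]
  rw [hpi, lintegral_map (by fun_prop) (by fun_prop)]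

/-- Given the pairs of functions, the published numbers are independent rescaled estimates of the
bitsum instances. -/
theorem lintegral_kdeProtocol_output {φ : (Fin I → Ω) × (Fin I × Fin Q → ℝ) → ℝ≥0∞}
    (hφ : Measurable φ) :
    ∫⁻ p, φ (p.1.1, p.2) ∂(kdeProtocol n I 𝒬 P).output D
      = ∫⁻ ω, ∫⁻ B, φ (ω, rescale n R B)
          ∂(Measure.pi fun ij : Fin I × Fin Q => roundedEstimate 𝒬 P D (ω ij.1) ij.2)
          ∂(Measure.pi fun _ => 𝒬.law) := by
  have hres : Measurable (rescale n R : (Fin I × Fin Q → ℝ) → _) := measurable_rescale n R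
  have hχ : Measurable fun q : (KDESeed I Q Ω W) × (Fin I × Fin Q → List M) =>
      ∫⁻ B, φ (q.1.1, rescale n R B)
        ∂Measure.pi fun ij : Fin I × Fin Q => P.analyzer (q.1.2 ij, q.2 ij) := by
    have := Measurable.lintegral_kernel_prod_right'
      (κ := piKernel fun ij : Fin I × Fin Q => P.analyzer.comap
        (fun q : (KDESeed I Q Ω W) × (Fin I × Fin Q → List M) => (q.1.2 ij, q.2 ij))
        (by fun_prop))
      (f := fun q => φ (q.1.1.1, rescale n R q.2)) (by fun_prop)
    exact this
  have hsel : Measurable fun (l : List (M × (Fin I × Fin Q))) (ij : Fin I × Fin Q) => select ij l :=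
    measurable_pi_lambda _ fun ij => measurable_select ij
  have hχ' : Measurable fun q : KDESeed I Q Ω W × List (M × (Fin I × Fin Q)) =>
      ∫⁻ B, φ (q.1.1, rescale n R B)
        ∂Measure.pi fun ij : Fin I × Fin Q => P.analyzer (q.1.2 ij, select ij q.2) :=
    hχ.comp (measurable_fst.prodMk (hsel.comp measurable_snd))
  rw [Protocol.output, lintegral_map (by fun_prop) (by fun_prop),
    Measure.lintegral_compProd (by fun_prop)]
  have han : ∀ q : KDESeed I Q Ω W × List (M × (Fin I × Fin Q)),
      ∫⁻ F, φ (q.1.1, F) ∂(kdeProtocol n I 𝒬 P).analyzer q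
        = ∫⁻ B, φ (q.1.1, rescale n R B)
          ∂Measure.pi fun ij : Fin I × Fin Q => P.analyzer (q.1.2 ij, select ij q.2) := fun q => by
    change ∫⁻ F, φ (q.1.1, F) ∂((piKernel (instanceAnalyzer I P Ω)).map (rescale n R)) q = _
    rw [Kernel.lintegral_map _ hres _ (by fun_prop)]
    rfl
  simp_rw [han]
  rw [lintegral_kdeProtocol_view 𝒬 P D hχ']
  refine lintegral_congr fun ω => ?_
  have hχω : Measurable fun q : (Fin I × Fin Q → W) × (Fin I × Fin Q → List M) =>
      ∫⁻ B, φ (ω, rescale n R B)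
        ∂Measure.pi fun ij : Fin I × Fin Q => P.analyzer (q.1 ij, q.2 ij) :=
    hχ.comp ((measurable_const.prodMk measurable_fst).prodMk measurable_snd)
  -- Each analyzer reads only its own label, so the global shuffle may be replaced by independent
  -- shuffles, which the views then absorb.
  have hind : ∀ v : Fin I × Fin Q → W × List M,
      ∫⁻ l, ∫⁻ B, φ (ω, rescale n R B)
        ∂(Measure.pi fun ij : Fin I × Fin Q => P.analyzer ((v ij).1, select ij l))
        ∂shuffle _ (tagAll fun ij => (v ij).2)
      = ∫⁻ Λ, ∫⁻ B, φ (ω, rescale n R B)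
        ∂(Measure.pi fun ij : Fin I × Fin Q => P.analyzer ((v ij).1, Λ ij))
        ∂Measure.pi (fun ij => shuffle M (v ij).2) := fun v =>
    lintegral_select_shuffle_tagAll (fun ij => (v ij).2)
      (φ := fun Λ => ∫⁻ B, φ (ω, rescale n R B)
        ∂(Measure.pi fun ij : Fin I × Fin Q => P.analyzer ((v ij).1, Λ ij)))
      (hχω.comp measurable_prodMk_left)
  simp_rw [hind]
  refine (lintegral_pi_shuffle_roundedView 𝒬 P D ω hχω).trans ?_
  have hbind := pi_bind (fun ij : Fin I × Fin Q => roundedView 𝒬 P D (ω ij.1) ij.2)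
    (κ := fun _ => P.analyzer) fun _ => P.analyzer.measurable
  simp_rw [roundedView_bind_analyzer] at hbind
  have hmeas : Measurable fun v : Fin I × Fin Q → W × List M =>
      Measure.pi fun ij => P.analyzer (v ij) :=
    measurable_measure_pi fun ij => P.analyzer.measurable.comp (measurable_pi_apply ij)
  rw [← hbind, Measure.lintegral_bind hmeas.aemeasurable (by fun_prop)]

end Output

/-! ### Second moments of independent sums -/

section SecondMoment

variable {α : Type*} [MeasurableSpace α] {μ : Measure α}

lemma eLpNorm_two_eq (f : α → ℝ) :
    eLpNorm f 2 μ = (∫⁻ a, ENNReal.ofReal (f a ^ 2) ∂μ) ^ (1 / 2 : ℝ) := by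
  rw [eLpNorm_eq_lintegral_rpow_enorm_toReal (by norm_num) (by norm_num)]
  congr 1
  refine lintegral_congr fun a => ?_
  rw [ENNReal.toReal_ofNat, ENNReal.rpow_ofNat, Real.enorm_eq_ofReal_abs,
    ← ENNReal.ofReal_pow (abs_nonneg _), sq_abs]

lemma eLpNorm_two_le_ofReal_sqrt_iff {f : α → ℝ} {V : ℝ} (hV : 0 ≤ V) :
    eLpNorm f 2 μ ≤ ENNReal.ofReal (Real.sqrt V)
      ↔ ∫⁻ a, ENNReal.ofReal (f a ^ 2) ∂μ ≤ ENNReal.ofReal V := by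
  rw [eLpNorm_two_eq, Real.sqrt_eq_rpow, ← ENNReal.ofReal_rpow_of_nonneg hV (by norm_num),
    ENNReal.rpow_le_rpow_iff (by norm_num)]

lemma memLp_two_of_lintegral_sq_le {f : α → ℝ} {V : ℝ} (hf : Measurable f) (hV : 0 ≤ V)
    (h : ∫⁻ a, ENNReal.ofReal (f a ^ 2) ∂μ ≤ ENNReal.ofReal V) :
    MemLp f 2 μ ∧ ∫ a, f a ^ 2 ∂μ ≤ V := by
  refine ⟨⟨hf.aestronglyMeasurable,
    ((eLpNorm_two_le_ofReal_sqrt_iff hV).2 h).trans_lt ENNReal.ofReal_lt_top⟩, ?_⟩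
  rw [integral_eq_lintegral_of_nonneg_ae (.of_forall fun _ => sq_nonneg _)
    (by fun_prop)]
  exact ENNReal.toReal_le_of_le_ofReal hV h

lemma lintegral_ofReal_sq {f : α → ℝ} (hf : MemLp f 2 μ) :
    ∫⁻ a, ENNReal.ofReal (f a ^ 2) ∂μ = ENNReal.ofReal (∫ a, f a ^ 2 ∂μ) :=
  (ofReal_integral_eq_lintegral_ofReal hf.integrable_sq (.of_forall fun _ => sq_nonneg _)).symm

lemma variance_le_integral_sq [IsProbabilityMeasure μ] {f : α → ℝ} (hf : MemLp f 2 μ) :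
    Var[f; μ] ≤ ∫ a, f a ^ 2 ∂μ :=
  variance_le_expectation_sq hf.aestronglyMeasurable

/-- The second moment of a sum of independent random variables. -/
lemma lintegral_sq_sum_add_const {ι : Type*} [Fintype ι] {Ω : ι → Type*}
    [∀ i, MeasurableSpace (Ω i)] {ν : ∀ i, Measure (Ω i)} [∀ i, IsProbabilityMeasure (ν i)]
    {X : ∀ i, Ω i → ℝ} (hX : ∀ i, MemLp (X i) 2 (ν i)) (c : ℝ) :
    ∫⁻ v, ENNReal.ofReal ((∑ i, X i (v i) + c) ^ 2) ∂Measure.pi ν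
      = ENNReal.ofReal (∑ i, Var[X i; ν i] + (∑ i, ∫ a, X i a ∂ν i + c) ^ 2) := by
  have hXi : ∀ i, MemLp (fun v : ∀ i, Ω i => X i (v i)) 2 (Measure.pi ν) := fun i =>
    (hX i).comp_measurePreserving (measurePreserving_eval ν i)
  have hsum : MemLp (fun v : ∀ i, Ω i => ∑ i, X i (v i)) 2 (Measure.pi ν) :=
    memLp_finsetSum _ fun i _ => hXi i
  have hadd : MemLp (fun v : ∀ i, Ω i => ∑ i, X i (v i) + c) 2 (Measure.pi ν) :=
    hsum.add (memLp_const c)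
  rw [lintegral_ofReal_sq hadd]
  congr 1
  have h1 := variance_eq_sub hadd
  rw [variance_add_const hsum.aestronglyMeasurable] at h1
  have h2 : Var[fun v : ∀ i, Ω i => ∑ i, X i (v i); Measure.pi ν] = ∑ i, Var[X i; ν i] := by
    rw [← variance_sum_pi hX]
    congr 1
    funext v
    simp
  have h3 : ∫ v, (∑ i, X i (v i) + c) ∂Measure.pi ν = ∑ i, ∫ a, X i a ∂ν i + c := by
    rw [integral_add (hsum.integrable one_le_two) (integrable_const _),
      integral_finsetSum _ fun i _ => (hXi i).integrable one_le_two]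
    simp only [integral_const, probReal_univ, smul_eq_mul, one_mul]
    congr 1
    exact Finset.sum_congr rfl fun i _ => integral_comp_eval (hX i).aestronglyMeasurable
  rw [h2, h3] at h1
  rw [h1]
  simp only [Pi.pow_apply]
  ring

/-- The mean squared error of the empirical mean of independent copies. -/
lemma lintegral_sq_mean_sub_le {I : ℕ} (hI : 0 < I) [IsProbabilityMeasure μ] {Z : α → ℝ}
    {V β h : ℝ} (hZ : MemLp Z 2 μ) (hV : ∫ a, Z a ^ 2 ∂μ ≤ V) (hβ : |∫ a, Z a ∂μ - h| ≤ β) :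
    ∫⁻ v, ENNReal.ofReal (((I : ℝ)⁻¹ * ∑ i, Z (v i) - h) ^ 2) ∂Measure.pi (fun _ : Fin I => μ)
      ≤ ENNReal.ofReal (β ^ 2 + (I : ℝ)⁻¹ * V) := by
  have hI' : (0 : ℝ) < I := by exact_mod_cast hI
  have h1 := lintegral_sq_sum_add_const (ι := Fin I) (ν := fun _ => μ)
    (X := fun _ a => (I : ℝ)⁻¹ * Z a) (fun _ => hZ.const_mul _) (-h)
  simp_rw [← Finset.mul_sum, ← sub_eq_add_neg] at h1
  rw [h1]
  refine ENNReal.ofReal_le_ofReal ?_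
  simp only [variance_const_mul, integral_const_mul, Finset.sum_const, Finset.card_univ,
    Fintype.card_fin, nsmul_eq_mul]
  have h2 : (I : ℝ) * ((I : ℝ)⁻¹ * ∫ a, Z a ∂μ) = ∫ a, Z a ∂μ := by field_simp
  have h3 : (I : ℝ) * ((I : ℝ)⁻¹ ^ 2 * Var[Z; μ]) = (I : ℝ)⁻¹ * Var[Z; μ] := by field_simp
  have h4 : (I : ℝ)⁻¹ * Var[Z; μ] ≤ (I : ℝ)⁻¹ * V := by
    gcongr
    exact (variance_le_integral_sq hZ).trans hV
  have h5 : (∫ a, Z a ∂μ - h) ^ 2 ≤ β ^ 2 := sq_le_sq' (abs_le.1 hβ).1 (abs_le.1 hβ).2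
  rw [h2, h3]
  linarith

/-- The second moment of a sparse combination of independent random variables. -/
lemma lintegral_sq_sparse_sum_le {ι : Type*} [Fintype ι] {ν : ι → Measure ℝ}
    [∀ i, IsProbabilityMeasure (ν i)] {S : ℕ} {c A m : ℝ} {a : ι → ℝ}
    (hA0 : 0 ≤ A) (hA : ∀ i, |a i| ≤ A) (hm : 0 ≤ m)
    (ha : (Finset.univ.filter fun i => a i ≠ 0).card ≤ S)
    (hmem : ∀ i, MemLp (fun x => x - c) 2 (ν i)) {V : ℝ}
    (hV0 : 0 ≤ V) (hV : ∀ i, ∫ x, (x - c) ^ 2 ∂ν i ≤ V) (hmean : ∀ i, |∫ x, (x - c) ∂ν i| ≤ m) :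
    ∫⁻ x, ENNReal.ofReal ((∑ i, a i * (x i - c)) ^ 2) ∂Measure.pi ν
      ≤ ENNReal.ofReal (S * (A ^ 2 * V) + (S * (A * m)) ^ 2) := by
  have h1 := lintegral_sq_sum_add_const (X := fun i x => a i * (x - c))
    (fun i => (hmem i).const_mul (a i)) 0
  simp only [add_zero] at h1
  rw [h1]
  refine ENNReal.ofReal_le_ofReal ?_
  simp only [variance_const_mul, integral_const_mul]
  -- Sparsity: at most `S` terms contribute, to the variance as well as to the mean.
  have hsupp : ∀ (F : ι → ℝ) {b : ℝ}, 0 ≤ b → (∀ i, a i = 0 → F i = 0) → (∀ i, F i ≤ b) →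
      ∑ i, F i ≤ S * b := by
    intro F b hb h0 hF
    classical
    rw [← Finset.sum_filter_of_ne (p := fun i => a i ≠ 0) fun i _ hi h => hi (h0 i h)]
    calc _ ≤ ((Finset.univ.filter fun i => a i ≠ 0).card : ℝ) * b := by
          rw [← nsmul_eq_mul]
          exact Finset.sum_le_card_nsmul _ _ _ fun i _ => hF i
      _ ≤ S * b := by gcongr
  have h2 : ∑ i, a i ^ 2 * Var[fun x => x - c; ν i] ≤ S * (A ^ 2 * V) := by
    refine hsupp _ (by positivity) (fun i hi => by rw [hi]; ring) fun i => ?_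
    have : a i ^ 2 ≤ A ^ 2 := sq_le_sq' (abs_le.1 (hA i)).1 (abs_le.1 (hA i)).2
    exact mul_le_mul this ((variance_le_integral_sq (hmem i)).trans (hV i)) (variance_nonneg _ _)
      (sq_nonneg _)
  have h3 : |∑ i, a i * ∫ x, (x - c) ∂ν i| ≤ S * (A * m) := by
    refine (Finset.abs_sum_le_sum_abs _ _).trans (hsupp _ (by positivity) (fun i hi => ?_)
      fun i => ?_)
    · rw [hi]; simp
    · rw [abs_mul]
      exact mul_le_mul (hA i) (hmean i) (abs_nonneg _) hA0
  have h4 := sq_le_sq' (abs_le.1 h3).1 (abs_le.1 h3).2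
  linarith

end SecondMoment

/-! ### The estimate of one instance on rounded bits -/

section RoundedEstimate

variable {d Q n : ℕ} {R : ℝ} {Ω W M : Type*} [MeasurableSpace Ω] [MeasurableSpace W]
  [MeasurableSpace M] (𝒬 : FunctionPairDist d Q R Ω) (P : Protocol (Fin 2) W M ℝ)
  (D : Fin n → EuclideanSpace ℝ (Fin d))

lemma bitSum_mem_Icc (b : Fin n → Fin 2) : bitSum b ∈ Set.Icc (0 : ℝ) n := by
  refine ⟨Finset.sum_nonneg fun u _ => Nat.cast_nonneg _, ?_⟩
  calc bitSum b ≤ ∑ _u : Fin n, (1 : ℝ) := Finset.sum_le_sum fun u _ => by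
        exact_mod_cast Nat.lt_succ_iff.1 (b u).2
    _ = n := by simp

lemma integral_bitSum (p : Fin n → unitInterval) : ∫ b, bitSum b ∂bits p = ∑ u, (p u : ℝ) := by
  unfold bitSum
  rw [integral_finsetSum _ fun u _ => .of_finite]
  refine Finset.sum_congr rfl fun u _ => ?_
  rw [bits, integral_comp_eval (μ := fun v => bernoulliMeasure (1 : Fin 2) 0 (p v)) (i := u)
    (f := fun c : Fin 2 => ((c : ℕ) : ℝ))
    (measurable_of_countable _).aestronglyMeasurable, integral_bernoulliMeasure]
  simp

/-- For every bit vector with sum `s`, `(x - n/2)² ≤ 2 (x - s)² + 2 (s - n/2)²`, and `s ∈ [0, n]`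
bounds the last term by `n²/2`. Being uniform in the bits, the bound survives rounding. -/
lemma lintegral_sq_roundedEstimate_le {𝓔 : ℝ≥0} (hrmse : bitsumRMSE n P ≤ 𝓔) (ω : Ω) (j : Fin Q) :
    ∫⁻ x, ENNReal.ofReal ((x - n / 2) ^ 2) ∂roundedEstimate 𝒬 P D ω j
      ≤ ENNReal.ofReal (2 * (𝓔 : ℝ) ^ 2 + n ^ 2 / 2) := by
  have hb : ∀ b : Fin n → Fin 2, ∫⁻ x, ENNReal.ofReal ((x - n / 2) ^ 2)
      ∂(P.output b).map Prod.snd ≤ ENNReal.ofReal (2 * (𝓔 : ℝ) ^ 2 + n ^ 2 / 2) := by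
    intro b
    have h1 : eLpNorm (fun p : W × ℝ => p.2 - bitSum b) 2 (P.output b)
        ≤ ENNReal.ofReal (Real.sqrt ((𝓔 : ℝ) ^ 2)) := by
      rw [Real.sqrt_sq (NNReal.coe_nonneg 𝓔), ENNReal.ofReal_coe_nnreal]
      exact (le_iSup (fun b : Fin n → Fin 2 =>
        eLpNorm (fun p : W × ℝ => p.2 - bitSum b) 2 (P.output b)) b).trans hrmse
    rw [eLpNorm_two_le_ofReal_sqrt_iff (sq_nonneg _)] at h1
    rw [lintegral_map (by fun_prop) measurable_snd]
    have hs := bitSum_mem_Icc b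
    have hpt : ∀ x : ℝ, ENNReal.ofReal ((x - n / 2) ^ 2)
        ≤ 2 * ENNReal.ofReal ((x - bitSum b) ^ 2) + ENNReal.ofReal (n ^ 2 / 2) := by
      intro x
      rw [show (2 : ℝ≥0∞) = ENNReal.ofReal 2 by simp, ← ENNReal.ofReal_mul (by norm_num),
        ← ENNReal.ofReal_add (by positivity) (by positivity)]
      refine ENNReal.ofReal_le_ofReal ?_
      nlinarith [sq_nonneg ((x - bitSum b) - (bitSum b - n / 2)),
        mul_nonneg hs.1 (sub_nonneg.2 hs.2)]
    calc ∫⁻ p : W × ℝ, ENNReal.ofReal ((p.2 - n / 2) ^ 2) ∂P.output b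
        ≤ ∫⁻ p : W × ℝ, (2 * ENNReal.ofReal ((p.2 - bitSum b) ^ 2) + ENNReal.ofReal (n ^ 2 / 2))
          ∂P.output b := lintegral_mono fun p => hpt p.2
      _ = 2 * ∫⁻ p : W × ℝ, ENNReal.ofReal ((p.2 - bitSum b) ^ 2) ∂P.output b
          + ENNReal.ofReal (n ^ 2 / 2) := by
          rw [lintegral_add_right _ measurable_const, lintegral_const_mul _ (by fun_prop)]
          simp
      _ ≤ 2 * ENNReal.ofReal ((𝓔 : ℝ) ^ 2) + ENNReal.ofReal (n ^ 2 / 2) := by gcongr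
      _ = _ := by
          rw [ENNReal.ofReal_add (by positivity) (by positivity),
            ENNReal.ofReal_mul (by norm_num)]
          simp
  rw [roundedEstimate, Measure.lintegral_bind (measurable_of_countable _).aemeasurable
    (by fun_prop)]
  calc _ ≤ ∫⁻ _, ENNReal.ofReal (2 * (𝓔 : ℝ) ^ 2 + n ^ 2 / 2) ∂bits (roundingProbs 𝒬 D ω j) :=
        lintegral_mono hb
    _ = _ := by simp

lemma integral_roundedEstimate (hunb : IsUnbiasedBitsum n P) (ω : Ω) (j : Fin Q)
    (hint : Integrable (fun x => x) (roundedEstimate 𝒬 P D ω j)) :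
    ∫ x, x ∂roundedEstimate 𝒬 P D ω j = ∑ u, (roundingProb 𝒬 ω (D u) j : ℝ) := by
  set κ : Kernel (Fin n → Fin 2) ℝ :=
    ⟨fun b => (P.output b).map Prod.snd, measurable_of_countable _⟩
  have h1 : ∫ x, x ∂(κ ∘ₘ bits (roundingProbs 𝒬 D ω j))
      = ∫ b, ∫ x, x ∂κ b ∂bits (roundingProbs 𝒬 D ω j) := by
    have hint' : Integrable (fun x => x) (κ ∘ₘ bits (roundingProbs 𝒬 D ω j)) := hint
    rw [Measure.comp_eq_comp_const_apply] at hint' ⊢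
    rw [Kernel.integral_comp hint', Kernel.const_apply]
  refine h1.trans ?_
  have h2 : ∀ b, ∫ x, x ∂κ b = bitSum b := fun b => by
    rw [← (hunb b).2]
    exact integral_map measurable_snd.aemeasurable measurable_id.aestronglyMeasurable
  simp_rw [h2]
  exact integral_bitSum _

lemma measurable_roundedEstimate (j : Fin Q) :
    Measurable fun ω => roundedEstimate 𝒬 P D ω j := by
  have h1 : Measurable fun ω => bits (roundingProbs 𝒬 D ω j) := by
    refine measurable_measure_pi (fun u => Measure.measurable_of_measurable_coe _ fun s _ => ?_)
    have hp : Measurable fun ω => roundingProb 𝒬 ω (D u) j :=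
      ((((𝒬.measurable_f (D u) j).div_const R).const_add 1).div_const 2).subtype_mk
    have hB : Measurable fun p : unitInterval => bernoulliMeasure (1 : Fin 2) 0 p s := by
      simp only [bernoulliMeasure_def, Measure.coe_add, Pi.add_apply, Measure.smul_apply]
      exact ((measurable_coe_nnreal_ennreal.comp (Continuous.measurable (by fun_prop))).mul_const
        _).add ((measurable_coe_nnreal_ennreal.comp (Continuous.measurable (by fun_prop))).mul_const
        _)
    exact hB.comp hp
  exact (Measure.measurable_bind' (measurable_of_countable _)).comp h1

end RoundedEstimate

/-! ### Bias and variance of the released function -/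

section MeanSquaredError

variable {d Q S n I : ℕ} {R β : ℝ} {𝓔 : ℝ≥0} {Ω W M : Type*} [MeasurableSpace Ω]
  [MeasurableSpace W] [MeasurableSpace M] (𝒬 : FunctionPairDist d Q R Ω)
  (P : Protocol (Fin 2) W M ℝ) (D : Fin n → EuclideanSpace ℝ (Fin d))

/-- The estimates of the instances that belong to one pair of functions. -/
def blockEstimates : Kernel Ω (Fin Q → ℝ) where
  toFun ω := Measure.pi fun j => roundedEstimate 𝒬 P D ω j
  measurable' := measurable_measure_pi fun j => measurable_roundedEstimate 𝒬 P D j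

instance : IsMarkovKernel (blockEstimates 𝒬 P D) :=
  ⟨fun ω => inferInstanceAs (IsProbabilityMeasure (Measure.pi fun j => roundedEstimate 𝒬 P D ω j))⟩

/-- The estimate of `KDE_D(y)` from one pair of functions. -/
def blockQuery (n : ℕ) (y : EuclideanSpace ℝ (Fin d)) (q : Ω × (Fin Q → ℝ)) : ℝ :=
  ∑ j, 2 * R / n * 𝒬.g q.1 y j * (q.2 j - n / 2)

lemma measurable_blockQuery (y : EuclideanSpace ℝ (Fin d)) : Measurable (blockQuery 𝒬 n y) := by
  unfold blockQuery
  refine Finset.measurable_sum _ fun j _ => ?_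
  have h : Measurable fun q : Ω × (Fin Q → ℝ) => 𝒬.g q.1 y j :=
    (𝒬.measurable_g y j).comp measurable_fst
  exact (h.const_mul _).mul (by fun_prop)

omit [MeasurableSpace W] in
lemma kdeQuery_rescale (w : KDESeed I Q Ω W) (B : Fin I × Fin Q → ℝ)
    (y : EuclideanSpace ℝ (Fin d)) :
    kdeQuery n I 𝒬 w (rescale n R B) y
      = (I : ℝ)⁻¹ * ∑ i, blockQuery 𝒬 n y (w.1 i, fun j => B (i, j)) := by
  unfold kdeQuery blockQuery rescale
  rw [one_div, mul_inv, mul_comm (n : ℝ)⁻¹, mul_assoc, Finset.mul_sum]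
  congr 1
  refine Finset.sum_congr rfl fun i _ => ?_
  rw [Finset.mul_sum]
  refine Finset.sum_congr rfl fun j _ => ?_
  ring

variable {P} in
lemma memLp_roundedEstimate (hrmse : bitsumRMSE n P ≤ 𝓔) (ω : Ω) (j : Fin Q) :
    MemLp (fun x => x - (n / 2 : ℝ)) 2 (roundedEstimate 𝒬 P D ω j) ∧
      ∫ x, (x - n / 2) ^ 2 ∂roundedEstimate 𝒬 P D ω j ≤ 2 * (𝓔 : ℝ) ^ 2 + n ^ 2 / 2 :=
  memLp_two_of_lintegral_sq_le (by fun_prop) (by positivity)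
    (lintegral_sq_roundedEstimate_le 𝒬 P D hrmse ω j)

variable {P} in
lemma integral_sub_roundedEstimate (hunb : IsUnbiasedBitsum n P) (hrmse : bitsumRMSE n P ≤ 𝓔)
    (ω : Ω) (j : Fin Q) :
    ∫ x, (x - n / 2) ∂roundedEstimate 𝒬 P D ω j = ∑ u, 𝒬.f ω (D u) j / R / 2 := by
  have h1 := (memLp_roundedEstimate 𝒬 D hrmse ω j).1.integrable one_le_two
  have hint : Integrable (fun x => x) (roundedEstimate 𝒬 P D ω j) := by
    have := h1.add (integrable_const (n / 2 : ℝ))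
    refine this.congr (.of_forall fun x => ?_)
    simp
  rw [integral_sub hint (integrable_const _), integral_roundedEstimate 𝒬 P D hunb ω j hint]
  have h2 : ∀ u, (roundingProb 𝒬 ω (D u) j : ℝ) = 1 / 2 + 𝒬.f ω (D u) j / R / 2 := fun u => by
    change (1 + 𝒬.f ω (D u) j / R) / 2 = _
    ring
  simp_rw [h2]
  rw [Finset.sum_add_distrib]
  simp only [integral_const, probReal_univ, smul_eq_mul, Finset.sum_const, Finset.card_univ,
    Fintype.card_fin, nsmul_eq_mul]
  ring

variable {P} in
-- A sparse sum with coefficients at most `2R²/n`, whose centred estimates have mean at most `n/2`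
-- in absolute value and second moment at most `2𝓔² + n²/2`. Only the sparsity of `g` matters here.
lemma lintegral_sq_blockQuery_le (hn : 0 < n) (hR : 0 < R)
    (hg : ∀ ω y, (Finset.univ.filter fun j => 𝒬.g ω y j ≠ 0).card ≤ S)
    (hunb : IsUnbiasedBitsum n P) (hrmse : bitsumRMSE n P ≤ 𝓔) (y : EuclideanSpace ℝ (Fin d))
    (ω : Ω) :
    ∫⁻ B, ENNReal.ofReal (blockQuery 𝒬 n y (ω, B) ^ 2) ∂blockEstimates 𝒬 P D ω
      ≤ ENNReal.ofReal (16 * R ^ 4 * S * (S + ((𝓔 : ℝ) / n) ^ 2)) := by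
  have hn' : (0 : ℝ) < n := by exact_mod_cast hn
  have hgR : ∀ j, |𝒬.g ω y j| ≤ R := fun j => abs_le.2 (𝒬.g_mem ω y j)
  have hmean : ∀ j, |∫ x, (x - n / 2) ∂roundedEstimate 𝒬 P D ω j| ≤ (n / 2 : ℝ) := by
    intro j
    rw [integral_sub_roundedEstimate 𝒬 D hunb hrmse]
    refine (Finset.abs_sum_le_sum_abs _ _).trans ?_
    calc _ ≤ ∑ _u : Fin n, (1 / 2 : ℝ) := by
          refine Finset.sum_le_sum fun u _ => ?_
          have hf : |𝒬.f ω (D u) j| ≤ R := abs_le.2 (𝒬.f_mem ω (D u) j)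
          rw [abs_div, abs_div, abs_of_pos hR, abs_of_pos (by norm_num : (0 : ℝ) < 2)]
          gcongr
          exact div_le_one_of_le₀ hf hR.le
      _ = n / 2 := by
          simp only [Finset.sum_const, Finset.card_univ, Fintype.card_fin, nsmul_eq_mul]
          ring
  refine (lintegral_sq_sparse_sum_le (ν := fun j => roundedEstimate 𝒬 P D ω j) (S := S)
    (A := 2 * R / n * R) (m := n / 2) (c := n / 2) (a := fun j => 2 * R / n * 𝒬.g ω y j)
    (V := 2 * (𝓔 : ℝ) ^ 2 + n ^ 2 / 2) (by positivity) (fun j => ?_) (by positivity) ?_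
    (fun j => (memLp_roundedEstimate 𝒬 D hrmse ω j).1) (by positivity)
    (fun j => (memLp_roundedEstimate 𝒬 D hrmse ω j).2) hmean).trans
    (ENNReal.ofReal_le_ofReal ?_)
  · rw [abs_mul, abs_of_nonneg (by positivity)]
    exact mul_le_mul_of_nonneg_left (hgR j) (by positivity)
  · refine (Finset.card_le_card fun j hj => ?_).trans (hg ω y)
    rw [Finset.mem_filter] at hj ⊢
    exact ⟨Finset.mem_univ _, fun h0 => hj.2 (by rw [h0, mul_zero])⟩
  · have hS : (S : ℝ) ≤ S ^ 2 := by
      exact_mod_cast Nat.le_self_pow two_ne_zero S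
    have h1 : S * ((2 * R / n * R) ^ 2 * (2 * (𝓔 : ℝ) ^ 2 + n ^ 2 / 2))
        + (S * (2 * R / n * R * (n / 2))) ^ 2
        = 8 * R ^ 4 * S * ((𝓔 : ℝ) / n) ^ 2 + R ^ 4 * (2 * S + S ^ 2) := by
      field_simp
      ring
    have h2 : R ^ 4 * (2 * S + S ^ 2) ≤ R ^ 4 * (16 * (S : ℝ) ^ 2) := by
      gcongr
      linarith [sq_nonneg (S : ℝ)]
    have h3 : 0 ≤ R ^ 4 * S * ((𝓔 : ℝ) / n) ^ 2 := by positivity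
    rw [h1]
    linarith

variable {P} in
-- Unbiasedness and the rounding probabilities give the centred mean `∑ᵤ f(xᵤ)ⱼ / (2R)`; the
-- coefficient `2R/n` undoes the scaling, and what remains is the average over users of the LSQ
-- error.
lemma abs_integral_blockQuery_sub_kde_le (hn : 0 < n) (hR : 0 < R)
    {k : EuclideanSpace ℝ (Fin d) → EuclideanSpace ℝ (Fin d) → ℝ}
    (hk : ∀ x y, |k x y - ∫ ω, ∑ j, 𝒬.f ω x j * 𝒬.g ω y j ∂𝒬.law| ≤ β)
    (hunb : IsUnbiasedBitsum n P) (hrmse : bitsumRMSE n P ≤ 𝓔) (y : EuclideanSpace ℝ (Fin d))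
    (hint : Integrable (blockQuery 𝒬 n y) (𝒬.law ⊗ₘ blockEstimates 𝒬 P D)) :
    |∫ q, blockQuery 𝒬 n y q ∂(𝒬.law ⊗ₘ blockEstimates 𝒬 P D) - kde k D y| ≤ β := by
  have hn' : (0 : ℝ) < n := by exact_mod_cast hn
  have hinner : ∀ ω, ∫ B, blockQuery 𝒬 n y (ω, B) ∂blockEstimates 𝒬 P D ω
      = (n : ℝ)⁻¹ * ∑ u, ∑ j, 𝒬.f ω (D u) j * 𝒬.g ω y j := by
    intro ω
    have hj : ∀ j, Integrable (fun x => x - (n / 2 : ℝ)) (roundedEstimate 𝒬 P D ω j) :=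
      fun j => (memLp_roundedEstimate 𝒬 D hrmse ω j).1.integrable one_le_two
    change ∫ B, ∑ j, 2 * R / n * 𝒬.g ω y j * (B j - n / 2)
      ∂(Measure.pi fun j => roundedEstimate 𝒬 P D ω j) = _
    rw [integral_finsetSum _ fun j _ => (integrable_comp_eval
        (μ := fun j => roundedEstimate 𝒬 P D ω j) (i := j) (f := fun x => x - (n / 2 : ℝ))
        (hj j)).const_mul _,
      Finset.sum_comm, Finset.mul_sum]
    refine Finset.sum_congr rfl fun j _ => ?_
    rw [integral_const_mul,
      integral_comp_eval (μ := fun j => roundedEstimate 𝒬 P D ω j) (i := j)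
        (f := fun x => x - (n / 2 : ℝ)) (hj j).aestronglyMeasurable,
      integral_sub_roundedEstimate 𝒬 D hunb hrmse, Finset.mul_sum, Finset.mul_sum]
    refine Finset.sum_congr rfl fun u _ => ?_
    field_simp
  have hfg : ∀ u, Integrable (fun ω => ∑ j, 𝒬.f ω (D u) j * 𝒬.g ω y j) 𝒬.law := by
    intro u
    refine integrable_finsetSum _ fun j _ => Integrable.of_bound (C := R * R)
      ((𝒬.measurable_f _ j).mul (𝒬.measurable_g y j)).aestronglyMeasurable (.of_forall fun ω => ?_)
    rw [Real.norm_eq_abs, abs_mul]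
    exact mul_le_mul (abs_le.2 (𝒬.f_mem ω (D u) j)) (abs_le.2 (𝒬.g_mem ω y j)) (abs_nonneg _) hR.le
  rw [Measure.integral_compProd hint]
  simp_rw [hinner]
  rw [integral_const_mul, integral_finsetSum _ fun u _ => hfg u, kde, one_div, ← mul_sub,
    ← Finset.sum_sub_distrib, abs_mul, abs_of_pos (inv_pos.2 hn'), inv_mul_le_iff₀ hn']
  calc |∑ u, (∫ ω, ∑ j, 𝒬.f ω (D u) j * 𝒬.g ω y j ∂𝒬.law - k (D u) y)|
      ≤ ∑ u, |∫ ω, ∑ j, 𝒬.f ω (D u) j * 𝒬.g ω y j ∂𝒬.law - k (D u) y| :=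
        Finset.abs_sum_le_sum_abs _ _
    _ ≤ ∑ _u : Fin n, β := Finset.sum_le_sum fun u _ => by
        rw [abs_sub_comm]
        exact hk _ _
    _ = n * β := by simp

variable {P} in
theorem supRMSE_kdeProtocol_le (hn : 0 < n) (hI : 0 < I) (hR : 0 < R)
    {k : EuclideanSpace ℝ (Fin d) → EuclideanSpace ℝ (Fin d) → ℝ} (h𝒬 : IsLSQ 𝒬 k β S)
    (hunb : IsUnbiasedBitsum n P) (hrmse : bitsumRMSE n P ≤ 𝓔) :
    supRMSE (kdeProtocol n I 𝒬 P) (kdeQuery n I 𝒬) k D ≤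
      ENNReal.ofReal (Real.sqrt (β ^ 2 +
        (I : ℝ)⁻¹ * (16 * R ^ 4 * S * (S + ((𝓔 : ℝ) / n) ^ 2)))) := by
  refine iSup_le fun y => ?_
  rw [eLpNorm_two_le_ofReal_sqrt_iff (by positivity)]
  set V : ℝ := 16 * R ^ 4 * S * (S + ((𝓔 : ℝ) / n) ^ 2) with hV
  have hZ := measurable_blockQuery (n := n) 𝒬 y
  have hsq : ∫⁻ q, ENNReal.ofReal (blockQuery 𝒬 n y q ^ 2) ∂(𝒬.law ⊗ₘ blockEstimates 𝒬 P D)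
      ≤ ENNReal.ofReal V := by
    rw [Measure.lintegral_compProd (by fun_prop)]
    calc _ ≤ ∫⁻ _, ENNReal.ofReal V ∂𝒬.law := lintegral_mono fun ω =>
          lintegral_sq_blockQuery_le 𝒬 D hn hR h𝒬.2.2 hunb hrmse y ω
      _ = _ := by simp
  obtain ⟨hmem, hle⟩ := memLp_two_of_lintegral_sq_le hZ (by positivity) hsq
  have hbias := abs_integral_blockQuery_sub_kde_le 𝒬 D hn hR h𝒬.1 hunb hrmse y
    (hmem.integrable one_le_two)
  refine le_trans (le_of_eq ?_) (lintegral_sq_mean_sub_le hI hmem hle hbias)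
  have hZi : ∀ i : Fin I, Measurable fun q : (Fin I → Ω) × (Fin I → Fin Q → ℝ) =>
      blockQuery 𝒬 n y (q.1 i, q.2 i) := fun i => hZ.comp (by fun_prop)
  have hφ : Measurable fun q : (Fin I → Ω) × (Fin I × Fin Q → ℝ) =>
      ENNReal.ofReal (((1 / ((n : ℝ) * I)) * ∑ i, ∑ j, q.2 (i, j) * 𝒬.g (q.1 i) y j
        - kde k D y) ^ 2) := by
    have hg : ∀ (i : Fin I) (j : Fin Q), Measurable fun q : (Fin I → Ω) × (Fin I × Fin Q → ℝ) =>
        𝒬.g (q.1 i) y j := fun i j => (𝒬.measurable_g y j).comp (by fun_prop)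
    fun_prop
  refine (lintegral_kdeProtocol_output 𝒬 P D hφ).trans ?_
  have hΨ : Measurable fun q : (Fin I → Ω) × (Fin I → Fin Q → ℝ) =>
      ENNReal.ofReal (((I : ℝ)⁻¹ * ∑ i, blockQuery 𝒬 n y (q.1 i, q.2 i) - kde k D y) ^ 2) := by
    fun_prop
  refine Eq.trans ?_ (lintegral_pi_compProd (fun _ : Fin I => 𝒬.law)
    (fun _ => blockEstimates 𝒬 P D) hΨ).symm
  refine lintegral_congr fun ω => ?_
  have hcurry : Measure.pi (fun i => blockEstimates 𝒬 P D (ω i))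
      = (Measure.pi fun ij : Fin I × Fin Q => roundedEstimate 𝒬 P D (ω ij.1) ij.2).map
        fun B i j => B (i, j) :=
    (pi_map_curry fun i j => roundedEstimate 𝒬 P D (ω i) j).symm
  rw [hcurry, lintegral_map (by fun_prop) (by fun_prop)]
  refine lintegral_congr fun B => ?_
  -- The query reads only the function pairs, so a dummy seed serves for the bitsum instances.
  have hq := kdeQuery_rescale (W := Unit) 𝒬 (ω, fun _ => ()) B y (n := n)
  rw [← hq]
  rfl

end MeanSquaredError

/-! ### Bit-width and its optimality -/

section BitWidth

/-- A user who discretizes to `0`-bit values sends messages that are independent of her data. -/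
theorem HasBitWidth.view_eq {X W M ι Out : Type*} [MeasurableSpace W] [MeasurableSpace M]
    [MeasurableSpace ι] [Fintype ι] [MeasurableSpace Out] {P : Protocol X W (M × ι) Out}
    (h : HasBitWidth P 0) {n : ℕ} (D D' : Fin n → X) : P.view D = P.view D' := by
  obtain ⟨m, disc, enc, hdisc, henc, hm, hP⟩ := h
  -- Zero bits means at most `2 ^ 0 = 1` value, so a Markov kernel into such vectors has no freedom.
  have : Subsingleton (Fin m) := Fin.subsingleton_iff_le_one.2 (by simpa using hm)
  have hdisc_eq : ∀ x x', disc x = disc x' := by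
    intro x x'
    ext w s
    rcases s.eq_empty_or_nonempty with rfl | hs
    · simp
    · rw [Subsingleton.eq_univ_of_nonempty hs, measure_univ, measure_univ]
  have hrand : ∀ x x', P.randomizer x = P.randomizer x' := by
    intro x x'
    rw [hP, hP]
    simp only [discretizedRandomizer, hdisc_eq x x']
  have hsh : P.shuffled D = P.shuffled D' := by
    ext w : 1
    rw [Protocol.shuffled_apply, Protocol.shuffled_apply]
    have hu : (fun u => P.randomizer (D u) w) = fun u => P.randomizer (D' u) w :=
      funext fun u => by rw [hrand (D u) (D' u)]
    rw [hu]
  rw [Protocol.view, Protocol.view, hsh]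

theorem hasBitWidth_kdeProtocol {d Q n I : ℕ} {R : ℝ} {Ω W M : Type*} [MeasurableSpace Ω]
    [MeasurableSpace W] [MeasurableSpace M] (𝒬 : FunctionPairDist d Q R Ω)
    (P : Protocol (Fin 2) W M ℝ) : HasBitWidth (kdeProtocol n I 𝒬 P) 1 :=
  ⟨2, rounding I 𝒬 W, instanceRandomizer I P Ω, fun _ => inferInstance,
    fun _ _ => inferInstance, by norm_num, fun _ => rfl⟩

end BitWidth

end ShuffledDP

end

theorem theorem1 {d Q S n I : ℕ} {R β ε₀ δ₀ δ' : ℝ} {𝓔 : ℝ≥0}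
    {Ω W M : Type*} [MeasurableSpace Ω] [MeasurableSpace W] [MeasurableSpace M]
    (hn : 0 < n) (hI : 0 < I) (hR : 0 < R) (hε₀ : 0 ≤ ε₀) (hδ' : 0 < δ')
    (k : EuclideanSpace ℝ (Fin d) → EuclideanSpace ℝ (Fin d) → ℝ)
    (𝒬 : ShuffledDP.FunctionPairDist d Q R Ω) (h𝒬 : ShuffledDP.IsLSQ 𝒬 k β S)
    (P : ShuffledDP.Protocol (Fin 2) W M ℝ)
    (hDP : ShuffledDP.IsDP (n := n) ε₀ δ₀ P.view)
    (hunb : ShuffledDP.IsUnbiasedBitsum n P)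
    (hrmse : ShuffledDP.bitsumRMSE n P ≤ 𝓔)
    {ε δ : ℝ}
    (hε : ε = ε₀ * S * (Real.exp (ε₀ * S) - 1) * I
      + ε₀ * S * Real.sqrt (2 * I * Real.log (1 / δ')))
    (hδ : δ = I * S * δ₀ + δ') :
    ShuffledDP.IsDP (n := n) ε δ (ShuffledDP.kdeProtocol n I 𝒬 P).view ∧
    ShuffledDP.IsDP (n := n) ε δ (ShuffledDP.kdeProtocol n I 𝒬 P).output ∧
    (∀ D : Fin n → EuclideanSpace ℝ (Fin d),
      ShuffledDP.supRMSE (ShuffledDP.kdeProtocol n I 𝒬 P) (ShuffledDP.kdeQuery n I 𝒬) k D ≤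
        ENNReal.ofReal (Real.sqrt (4 * β ^ 2 +
          (I : ℝ)⁻¹ * (16 * R ^ 4 * S * (S + ((𝓔 : ℝ) / n) ^ 2))))) ∧
    ShuffledDP.HasBitWidth (ShuffledDP.kdeProtocol n I 𝒬 P) 1 ∧
    (∀ P' : ShuffledDP.Protocol (EuclideanSpace ℝ (Fin d)) (ShuffledDP.KDESeed I Q Ω W)
        (M × (Fin I × Fin Q)) (Fin I × Fin Q → ℝ),
      ShuffledDP.HasBitWidth P' 0 →
        ∀ D D' : Fin n → EuclideanSpace ℝ (Fin d), P'.view D = P'.view D') := by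
  -- Nonnegativity of `δ₀` follows from privacy tested on the empty event.
  have hδ₀ : 0 ≤ δ₀ := by
    have h := hDP (fun _ => 0) (fun _ => 0) (fun v hv => (hv rfl).elim) ∅ MeasurableSet.empty
    simpa using h
  have hc : ∀ D D' : Fin n → EuclideanSpace ℝ (Fin d), ShuffledDP.Neighboring D D' →
      ShuffledDP.Close (Real.exp ε).toNNReal (ENNReal.ofReal δ)
        ((ShuffledDP.kdeProtocol n I 𝒬 P).view D) ((ShuffledDP.kdeProtocol n I 𝒬 P).view D') := by
    intro D D' hD
    rw [hε, hδ]
    exact ShuffledDP.close_kdeProtocol_view hn hI hε₀ hδ₀ hδ' 𝒬 h𝒬.2.1 P hDP hD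
  have hδ0 : 0 ≤ δ := by
    rw [hδ]
    positivity
  refine ⟨fun D D' hD => ?_, fun D D' hD => ?_, fun D => ?_,
    ShuffledDP.hasBitWidth_kdeProtocol 𝒬 P, fun P' hP' D D' => hP'.view_eq D D'⟩
  · exact (ShuffledDP.close_iff_real (Real.exp_pos ε).le hδ0).1 (hc D D' hD)
  · exact (ShuffledDP.close_iff_real (Real.exp_pos ε).le hδ0).1 (hc D D' hD).output
  · refine (ShuffledDP.supRMSE_kdeProtocol_le 𝒬 D hn hI hR h𝒬 hunb hrmse).trans
      (ENNReal.ofReal_le_ofReal (Real.sqrt_le_sqrt ?_))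
    -- The sharper bias term `β²` is relaxed to `4β²`.
    linarith [sq_nonneg β]
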